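/- Let $\rho$ be a probability measure on $\mathbb{R}^p\times\mathbb{R}$ with $\mathbb{E}_\rho[\|\mathbf{x}\|^4]<+\infty$ and $\mathbb{E}_\rho[|\mathbf{y}|^4]<+\infty$, where $(\mathbf{x},\mathbf{y})\sim\rho$, and let $(x_i,y_i)_{i\ge 1}$ be i.i.d. with law $\rho$. Write $C=\mathbb{E}_\rho[\mathbf{x}\mathbf{x}^\top]$, let $C^\dagger$ be its Moore--Penrose pseudo-inverse, and write $\widehat C_n=\frac1n\sum_{i=1}^n x_ix_i^\top$ and $\widehat u_n=\frac1n\sum_{i=1}^n y_ix_i$. Let $R:\mathbb{R}^p\to\mathbb{R}\cup\{+\infty\}$ be proper, lower semicontinuous, convex, bounded from below, and mirror-stratifiable in the following sense. A stratification of a set $D$ is a finite partition of $D$ into nonempty sets such that $M\cap\operatorname{cl}M'\ne\emptyset$ implies $M\subset\operatorname{cl}M'$ for all members $M,M'$; one writes $M\le M'$ for $M\subset\operatorname{cl}M'$. For a function $F$ put $\mathcal{J}_F(S)=\bigcup_{x\in S}\operatorname{ri}(\partial F(x))$, and let $R^*$ be the Legendre--Fenchel conjugate of $R$. Then $R$ is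 mirror-stratifiable if there are stratifications $\mathcal{M}$ of $\operatorname{dom}\partial R$ and $\mathcal{M}^*$ of $\operatorname{dom}\partial R^*$ such that $\mathcal{J}_R:\mathcal{M}\to\mathcal{M}^*$ is a bijection with inverse $\mathcal{J}_{R^*}$ and $M\le M'$ implies $\mathcal{J}_R(M')\le\mathcal{J}_R(M)$. Assume that $w_0$ is the unique solution of $$\min\Big\{R(w) : w\in\operatorname*{Argmin}_{w'\in\mathbb{R}^p}\mathbb{E}_\rho\big[(\langle w',\mathbf{x}\rangle-\mathbf{y})^2\big]\Big\},$$ with $R(w_0)<+\infty$, and that $\partial R(w_0)\cap\operatorname{Im}C\neq\emptyset$. Let $(\lambda_n)_{n\in\mathbb{N}}\subset(0,+\infty)$ satisfy $\lambda_n\to0$ and $\lambda_n\sqrt{n/\log\log n}\to+\infty$. Then the problem $\min\{\langle C^\dagger\eta,\eta\rangle : \eta\in\partial R(w_0)\cap\operatorname{Im}C\}$ has a unique solution $\eta_0$, and, almost surely, the following holds: for all large enough $n$ the problem $$\min_{w\in\mathbb{R}^p}\ \lambda_nR(w)+\frac1{2n}\sum_{i=1}^n\big(\langle x_i,w\rangle-y_i\big)^2$$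 has a solution, and for every choice of a solution $\widehat w_{\lambda_n,n}$ for all large enough $n$, with dual vector $\widehat\eta_{\lambda_n,n}=(\widehat u_n-\widehat C_n\widehat w_{\lambda_n,n})/\lambda_n$, one has $$(\widehat w_{\lambda_n,n},\widehat\eta_{\lambda_n,n})\longrightarrow(w_0,\eta_0)\qquad\text{as } n\to+\infty .$$ -/

import Mathlib

noncomputable section

namespace MirrorERM

open MeasureTheory Set

/-- The space `ℝ^p` with its Euclidean inner product. -/
abbrev Vec (p : ℕ) : Type := EuclideanSpace ℝ (Fin p)

section Convex

variable {p : ℕ}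

/-- `R : ℝ^p → ℝ ∪ {+∞}` is proper: it never takes the value `-∞` and is finite somewhere. -/
def IsProper (R : Vec p → EReal) : Prop :=
  (∀ w, R w ≠ ⊥) ∧ ∃ w, R w ≠ ⊤

/-- Convexity of an extended-real-valued function: its epigraph is convex. -/
def IsConvex (R : Vec p → EReal) : Prop :=
  Convex ℝ {q : Vec p × ℝ | R q.1 ≤ (q.2 : EReal)}

/-- `R` is bounded from below by a real constant. -/
def IsBoundedBelow (R : Vec p → EReal) : Prop :=
  ∃ m : ℝ, ∀ w, (m : EReal) ≤ R w

/-- The (convex) subdifferential of `R` at `w`. -/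
def subdiff (R : Vec p → EReal) (w : Vec p) : Set (Vec p) :=
  {η | ∀ v, R w + ((inner ℝ η (v - w) : ℝ) : EReal) ≤ R v}

/-- The domain of the subdifferential of `R`. -/
def domSubdiff (R : Vec p → EReal) : Set (Vec p) :=
  {w | (subdiff R w).Nonempty}

/-- The Legendre-Fenchel conjugate of `R`. -/
def conj (R : Vec p → EReal) (η : Vec p) : EReal :=
  ⨆ w : Vec p, ((inner ℝ η w : ℝ) : EReal) - R w

/-- The correspondence operator `S ↦ ⋃_{x ∈ S} ri (∂R(x))`. -/
def corr (R : Vec p → EReal) (S : Set (Vec p)) : Set (Vec p) :=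
  ⋃ x ∈ S, intrinsicInterior ℝ (subdiff R x)

/-- `𝓜` is a stratification of `D`: a finite partition of `D` into nonempty sets such that a stratum
that meets the closure of another one is contained in that closure. -/
structure IsStratification (𝓜 : Set (Set (Vec p))) (D : Set (Vec p)) : Prop where
  finite : 𝓜.Finite
  nonempty : ∀ M ∈ 𝓜, M.Nonempty
  disjoint : 𝓜.PairwiseDisjoint id
  cover : ⋃₀ 𝓜 = D
  frontier : ∀ M ∈ 𝓜, ∀ M' ∈ 𝓜, (M ∩ closure M').Nonempty → M ⊆ closure M'

/-- `R` is proper, lower semicontinuous and convex, and mirror-stratifiable with respect to the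
primal stratification `𝓜` of `dom ∂R` and the dual stratification `𝓜'` of `dom ∂R*`. The order on
strata is `M ≤ M' ↔ M ⊆ closure M'`. -/
structure IsMirrorStratifiableWith (R : Vec p → EReal) (𝓜 𝓜' : Set (Set (Vec p))) : Prop where
  proper : IsProper R
  lsc : LowerSemicontinuous R
  convex : IsConvex R
  primal : IsStratification 𝓜 (domSubdiff R)
  dual : IsStratification 𝓜' (domSubdiff (conj R))
  mapsTo : MapsTo (corr R) 𝓜 𝓜'
  mapsTo_inv : MapsTo (corr (conj R)) 𝓜' 𝓜
  invOn : InvOn (corr (conj R)) (corr R) 𝓜 𝓜'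
  decreasing : ∀ M₁ ∈ 𝓜, ∀ M₂ ∈ 𝓜, M₁ ⊆ closure M₂ → corr R M₂ ⊆ closure (corr R M₁)

/-- `R` is mirror-stratifiable (with respect to some pair of stratifications). -/
def IsMirrorStratifiable (R : Vec p → EReal) : Prop :=
  ∃ 𝓜 𝓜' : Set (Set (Vec p)), IsMirrorStratifiableWith R 𝓜 𝓜'

/-- The Moore-Penrose pseudo-inverse `A†` of a linear operator on `ℝ^p`: project `y` orthogonally
onto `Im A` and take the unique preimage of the projection under `A` in `(Ker A)ᗮ`. -/
def pinv (A : Vec p →ₗ[ℝ] Vec p) : Vec p →ₗ[ℝ] Vec p :=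
  (LinearMap.ker A)ᗮ.subtype ∘ₗ
    (A.kerComplementEquivRange
      (Submodule.isCompl_orthogonal (K := LinearMap.ker A)).symm
      ).symm.toLinearMap ∘ₗ
    ((LinearMap.range A).orthogonalProjectionOnto : Vec p →ₗ[ℝ] LinearMap.range A)

end Convex

section Population

variable {p : ℕ} (ρ : Measure (Vec p × ℝ)) (R : Vec p → EReal)

/-- The expected quadratic risk `E_ρ[(⟨w, x⟩ - y)²]`. -/
def risk (w : Vec p) : ℝ :=
  ∫ z, (inner ℝ w z.1 - z.2) ^ 2 ∂ρ

/-- `w` solves the problem of minimizing `R` over the minimizers of the expected quadratic risk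
(and the optimal value is finite). -/
def IsPopulationSol (w : Vec p) : Prop :=
  IsMinOn (risk ρ) univ w ∧ R w ≠ ⊤ ∧ IsMinOn R {v | IsMinOn (risk ρ) univ v} w

/-- The expected (non-centered) covariance operator `C = E_ρ[x xᵀ]`. -/
def cov : Vec p →ₗ[ℝ] Vec p :=
  Matrix.toEuclideanLin (Matrix.of fun i j => ∫ z, z.1 i * z.1 j ∂ρ)

/-- `η` solves the problem of minimizing `⟨C† η, η⟩` over `∂R(w) ∩ Im C`. -/
def IsDualSol (w η : Vec p) : Prop :=
  η ∈ subdiff R w ∩ (LinearMap.range (cov ρ) : Set (Vec p)) ∧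
    IsMinOn (fun ζ : Vec p => (inner ℝ (pinv (cov ρ) ζ) ζ : ℝ))
      (subdiff R w ∩ (LinearMap.range (cov ρ) : Set (Vec p))) η

end Population

section Empirical

variable {p : ℕ} (R : Vec p → EReal) (s : ℕ → Vec p × ℝ)

/-- The objective `λ R(w) + (1/2n) ∑_{i<n} (⟨x_i, w⟩ - y_i)²` of the regularized empirical risk
minimization problem, for the data `s i = (x_i, y_i)`. -/
def ermObjective (lam : ℝ) (n : ℕ) (w : Vec p) : EReal :=
  (lam : EReal) * R w +
    ((1 / (2 * (n : ℝ)) * ∑ i ∈ Finset.range n, (inner ℝ (s i).1 w - (s i).2) ^ 2 : ℝ) : EReal)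

/-- `w` solves the regularized empirical risk minimization problem. -/
def IsERMSol (lam : ℝ) (n : ℕ) (w : Vec p) : Prop :=
  IsMinOn (ermObjective R s lam n) univ w

/-- The empirical covariance operator `Ĉ_n = (1/n) ∑_{i<n} x_i x_iᵀ`. -/
def empCov (n : ℕ) : Vec p →ₗ[ℝ] Vec p :=
  Matrix.toEuclideanLin
    ((1 / (n : ℝ)) • ∑ i ∈ Finset.range n, Matrix.of fun j k => (s i).1 j * (s i).1 k)

/-- The vector `û_n = (1/n) ∑_{i<n} y_i x_i`. -/
def empU (n : ℕ) : Vec p :=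
  (1 / (n : ℝ)) • ∑ i ∈ Finset.range n, (s i).2 • (s i).1

/-- The dual vector `(û_n - Ĉ_n w) / λ` associated with a primal vector `w`. -/
def dualVec (lam : ℝ) (n : ℕ) (w : Vec p) : Vec p :=
  (1 / lam) • (empU s n - empCov s n w)

end Empirical

end MirrorERM

end

/-!
The problem is deterministic once two rates are known: almost surely `Ĉ_n - C = o(λ_n)` and
`û_n - E[y x] = o(λ_n)`.

**Rates.** The entries are empirical means of square-integrable variables, and `λ_n` dominates
`√(log log n / n)`, so the upper half of the Hartman-Wintner law of the iterated logarithm, up to a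
constant, is what is needed (`ae_sum_isBigO_sqrt_mul_log_log`). Each variable `X_i` is truncated at
`√(i / log log i)`. The bounded part is handled by Doob's maximal inequality for its exponential
submartingale and by Borel-Cantelli along dyadic blocks (`ae_eventually_sum_le_of_bounded`). The
part beyond the truncation level is summable with weights `1 / √(i log log i)`, because exchanging
sum and expectation bounds the expected weighted sum by a multiple of `E[X ^ 2]`
(`ae_exists_sum_abs_tailPart_le`).

**Primal limit.** Almost surely all `x_i` lie in `V = Im C`, so `Ĉ_n` vanishes on `Ker C = Vᗮ` and
is, for large `n`, coercive on `V`. Comparing a solution `w` with `w₀` through one element of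
`∂R(w₀) ∩ V`, the component of `w - w₀` in `V` and the excess `R w - R w₀` are both `O(λ_n)`
(`norm_starProjection_le_and_le`). Since `w₀` is the only minimizer of `R` over `w₀ + Ker C`,
convexity and compactness turn this into `w → w₀`, and the same localization provides the existence
of solutions (`exists_growth`).

**Dual limit.** By Fermat's rule the dual vectors `η_n` belong to `∂R(w_n) ∩ V`. With `q_n` the
component of `w_n - w₀` in `V` and `z_n = -q_n / λ_n`, which is bounded, `η_n = Ĉ_n z_n + o(1)`,
and monotonicity of `∂R` gives `⟨η_n - η, z_n⟩ ≤ 0` for all `η ∈ ∂R(w₀) ∩ V`. A cluster point `η` of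
`η_n` is thus feasible and satisfies `⟨η - ζ, C† η⟩ ≤ 0` for all feasible `ζ`, the variational
inequality that characterizes `η₀` (`exists_isMinOn_and_tendsto`).
-/

namespace MirrorERM

open MeasureTheory ProbabilityTheory Filter Topology

/-! ### The normalization of the law of the iterated logarithm -/

/-- A smooth substitute for `log (log n)`, of the same order of magnitude for large `n`, but
defined, at least `2` and slowly increasing for all `n`. -/
noncomputable def logScale (n : ℕ) : ℝ := 2 + Real.log (1 + Real.log n)

lemma two_le_logScale (n : ℕ) : 2 ≤ logScale n := by
  have : 0 ≤ Real.log (n : ℝ) := Real.log_natCast_nonneg n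
  have := Real.log_nonneg (show (1 : ℝ) ≤ 1 + Real.log n by linarith)
  unfold logScale; linarith

lemma logScale_pos (n : ℕ) : 0 < logScale n := by linarith [two_le_logScale n]

lemma logScale_mono : Monotone logScale := by
  intro m n h
  have h0 : 0 ≤ Real.log (m : ℝ) := Real.log_natCast_nonneg m
  have h1 : Real.log (m : ℝ) ≤ Real.log n := by
    rcases Nat.eq_zero_or_pos m with rfl | hm
    · simpa using Real.log_natCast_nonneg n
    · exact Real.log_le_log (by exact_mod_cast hm) (by exact_mod_cast h)
  unfold logScale
  gcongr

/-- The increments of `logScale` are at most `1 / n`. -/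
lemma mul_logScale_succ_sub_le (n : ℕ) : n * (logScale (n + 1) - logScale n) ≤ 1 := by
  rcases Nat.eq_zero_or_pos n with rfl | hn
  · simp
  have hn' : (0 : ℝ) < n := by exact_mod_cast hn
  have h0 : 0 ≤ Real.log (n : ℝ) := Real.log_natCast_nonneg n
  have h1 : 0 ≤ Real.log ((n + 1 : ℕ) : ℝ) := Real.log_natCast_nonneg _
  have key : ∀ x y : ℝ, 0 < x → 0 < y → Real.log y - Real.log x ≤ (y - x) / x := by
    intro x y hx hy
    rw [← Real.log_div hy.ne' hx.ne', sub_div, div_self hx.ne']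
    exact Real.log_le_sub_one_of_pos (by positivity)
  have k1 := key n ((n + 1 : ℕ) : ℝ) hn' (by positivity)
  have k2 := key (1 + Real.log n) (1 + Real.log ((n + 1 : ℕ) : ℝ)) (by positivity) (by positivity)
  have k3 : Real.log ((n + 1 : ℕ) : ℝ) - Real.log n ≤ 1 / n := by
    refine k1.trans (le_of_eq ?_)
    push_cast; ring
  have k4 : (1 + Real.log ((n + 1 : ℕ) : ℝ) - (1 + Real.log n)) / (1 + Real.log n) ≤ 1 / n := by
    rw [div_le_iff₀ (by positivity)]
    have : 1 / (n : ℝ) ≤ 1 / n * (1 + Real.log n) :=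
      le_mul_of_one_le_right (by positivity) (by linarith)
    linarith
  have k5 : logScale (n + 1) - logScale n ≤ 1 / n := by unfold logScale; linarith
  calc n * (logScale (n + 1) - logScale n) ≤ n * (1 / n) := by gcongr
    _ = 1 := by field_simp

/-- The truncation level `√(n / logScale n)`. -/
noncomputable def truncLevel (n : ℕ) : ℝ := √(n / logScale n)

/-- The normalization `√(n * logScale n)` of the law of the iterated logarithm. -/
noncomputable def lilScale (n : ℕ) : ℝ := √(n * logScale n)

lemma truncLevel_nonneg (n : ℕ) : 0 ≤ truncLevel n := Real.sqrt_nonneg _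

lemma lilScale_nonneg (n : ℕ) : 0 ≤ lilScale n := Real.sqrt_nonneg _

lemma truncLevel_pos {n : ℕ} (hn : 0 < n) : 0 < truncLevel n := by
  have := logScale_pos n
  exact Real.sqrt_pos.2 (by positivity)

lemma truncLevel_sq (n : ℕ) : truncLevel n ^ 2 = n / logScale n :=
  Real.sq_sqrt (div_nonneg (Nat.cast_nonneg _) (logScale_pos n).le)

lemma lilScale_eq (n : ℕ) : lilScale n = truncLevel n * logScale n := by
  have := logScale_pos n
  rw [lilScale, truncLevel, Real.sqrt_eq_iff_mul_self_eq (by positivity) (by positivity)]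
  rw [mul_mul_mul_comm, Real.mul_self_sqrt (by positivity)]
  field_simp

lemma lilScale_pos {n : ℕ} (hn : 0 < n) : 0 < lilScale n := by
  rw [lilScale_eq]; exact mul_pos (truncLevel_pos hn) (logScale_pos n)

lemma lilScale_mono : Monotone lilScale := by
  intro m n h
  unfold lilScale
  have := (logScale_pos m).le
  have := logScale_mono h
  gcongr

lemma truncLevel_sq_succ_sub (n : ℕ) :
    1 / (2 * logScale (n + 1)) ≤ truncLevel (n + 1) ^ 2 - truncLevel n ^ 2 := by
  rw [truncLevel_sq, truncLevel_sq]
  have h1 := mul_logScale_succ_sub_le n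
  have h2 := two_le_logScale n
  have h3 := logScale_pos (n + 1)
  have h4 := logScale_pos n
  push_cast
  rw [div_sub_div _ _ h3.ne' h4.ne', div_le_div_iff₀ (by positivity) (by positivity)]
  nlinarith [mul_nonneg h3.le (sub_nonneg.2 h1), mul_nonneg h3.le (sub_nonneg.2 h2)]

lemma truncLevel_mono : Monotone truncLevel := by
  refine monotone_nat_of_le_succ fun n => ?_
  have h := truncLevel_sq_succ_sub n
  have h3 := logScale_pos (n + 1)
  have : 0 ≤ 1 / (2 * logScale (n + 1)) := by positivity
  exact (sq_le_sq₀ (truncLevel_nonneg n) (truncLevel_nonneg _)).1 (by linarith)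

/-- The weights `1 / lilScale` are dominated by the increments of the truncation level. -/
lemma one_div_lilScale_succ_le (n : ℕ) :
    1 / lilScale (n + 1) ≤ 4 * (truncLevel (n + 1) - truncLevel n) := by
  have h := truncLevel_sq_succ_sub n
  have h3 := logScale_pos (n + 1)
  have hm := truncLevel_mono (Nat.le_succ n)
  have hp := truncLevel_pos (Nat.succ_pos n)
  have h0 := truncLevel_nonneg n
  simp only [Nat.succ_eq_add_one] at hm hp
  rw [lilScale_eq, div_le_iff₀ (mul_pos hp h3)]
  rw [div_le_iff₀ (by positivity)] at h
  nlinarith [mul_nonneg (mul_nonneg (sub_nonneg.2 hm) (sub_nonneg.2 hm)) h3.le]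

/-- Exchanging the roles of the level and of the index: the total weight of the indices at which
`x` exceeds the truncation level is at most `4 * x`. -/
lemma sum_indicator_truncLevel_le {x : ℝ} (hx : 0 ≤ x) (n : ℕ) :
    ∑ i ∈ Finset.range n, (if truncLevel (i + 1) < x then 1 / lilScale (i + 1) else 0) ≤ 4 * x := by
  suffices h : ∑ i ∈ Finset.range n, (if truncLevel (i + 1) < x then 1 / lilScale (i + 1) else 0)
      ≤ 4 * min (truncLevel n) x from h.trans (by gcongr; exact min_le_right _ _)
  induction n with
  | zero => simpa using le_min (truncLevel_nonneg 0) hx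
  | succ n ih =>
    rw [Finset.sum_range_succ]
    have hm := truncLevel_mono (Nat.le_succ n)
    simp only [Nat.succ_eq_add_one] at hm
    split_ifs with h
    · rw [min_eq_left (hm.trans h.le)] at ih
      rw [min_eq_left h.le]
      linarith [one_div_lilScale_succ_le n]
    · have : min (truncLevel n) x ≤ min (truncLevel (n + 1)) x := min_le_min_right _ hm
      linarith

lemma lilScale_two_pow_succ_le (k : ℕ) : lilScale (2 ^ (k + 1)) ≤ 2 * lilScale (2 ^ k) := by
  have h0 : (0 : ℝ) ≤ Real.log ((2 ^ k : ℕ) : ℝ) := Real.log_natCast_nonneg _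
  have hl2 : Real.log 2 ≤ 1 := by linarith [Real.log_two_lt_d9]
  have hl2' : 0 ≤ Real.log 2 := by positivity
  have e1 : Real.log ((2 ^ (k + 1) : ℕ) : ℝ) = Real.log ((2 ^ k : ℕ) : ℝ) + Real.log 2 := by
    push_cast
    rw [pow_succ, Real.log_mul (by positivity) (by norm_num)]
  have e2 : logScale (2 ^ (k + 1)) ≤ logScale (2 ^ k) + Real.log 2 := by
    have h : Real.log (1 + (Real.log ((2 ^ k : ℕ) : ℝ) + Real.log 2)) ≤
        Real.log ((1 + Real.log ((2 ^ k : ℕ) : ℝ)) * 2) :=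
      Real.log_le_log (by positivity) (by linarith)
    rw [Real.log_mul (by positivity) (by norm_num)] at h
    unfold logScale
    rw [e1]
    linarith
  have e3 : logScale (2 ^ (k + 1)) ≤ 2 * logScale (2 ^ k) := by
    linarith [two_le_logScale (2 ^ k)]
  have e4 : 2 * lilScale (2 ^ k) = √(4 * (((2 ^ k : ℕ) : ℝ) * logScale (2 ^ k))) := by
    rw [Real.sqrt_mul (by norm_num), show (4 : ℝ) = 2 ^ 2 by norm_num, Real.sqrt_sq (by norm_num),
      lilScale]
  rw [e4, lilScale]
  apply Real.sqrt_le_sqrt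
  push_cast
  rw [pow_succ]
  have : (0 : ℝ) < 2 ^ k := by positivity
  nlinarith

lemma summable_exp_neg_two_mul_logScale :
    Summable fun k : ℕ => Real.exp (-2 * logScale (2 ^ (k + 1))) := by
  have h2 : 0 < Real.log 2 := by positivity
  have hs : Summable fun k : ℕ => (1 / (Real.log 2) ^ 2) * (1 / (((k + 1 : ℕ) : ℝ)) ^ 2) := by
    apply Summable.mul_left
    exact (summable_nat_add_iff (f := fun k : ℕ => 1 / ((k : ℝ)) ^ 2) 1).2
      (Real.summable_one_div_nat_pow.2 (by norm_num))
  refine hs.of_nonneg_of_le (fun _ => (Real.exp_pos _).le) fun k => ?_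
  have e1 : Real.log ((2 ^ (k + 1) : ℕ) : ℝ) = (k + 1 : ℕ) * Real.log 2 := by
    push_cast
    rw [← Nat.cast_succ, Real.log_pow]
  have hk : (0 : ℝ) < (k + 1 : ℕ) := by positivity
  have hpos : 0 < 1 + (k + 1 : ℕ) * Real.log 2 := by positivity
  unfold logScale
  rw [e1, one_div_mul_one_div, ← mul_pow, mul_comm (Real.log 2)]
  calc Real.exp (-2 * (2 + Real.log (1 + (k + 1 : ℕ) * Real.log 2)))
      ≤ Real.exp (-(2 * Real.log (1 + (k + 1 : ℕ) * Real.log 2))) := by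
        apply Real.exp_le_exp.2; linarith
    _ = 1 / (1 + (k + 1 : ℕ) * Real.log 2) ^ 2 := by
        rw [Real.exp_neg, one_div, mul_comm, Real.exp_mul, Real.exp_log hpos]
        norm_cast
    _ ≤ _ := by
        apply one_div_le_one_div_of_le (by positivity)
        gcongr
        linarith

/-- `lilScale n` is of the order of `√(n log log n)`. -/
lemma eventually_lilScale_le :
    ∀ᶠ n : ℕ in atTop, lilScale n ≤ 2 * √(n * Real.log (Real.log n)) := by
  have ht : Tendsto (fun n : ℕ => Real.log (Real.log n)) atTop atTop :=
    Real.tendsto_log_atTop.comp (Real.tendsto_log_atTop.comp tendsto_natCast_atTop_atTop)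
  have ht1 : Tendsto (fun n : ℕ => Real.log n) atTop atTop :=
    Real.tendsto_log_atTop.comp tendsto_natCast_atTop_atTop
  filter_upwards [ht.eventually_ge_atTop 1, ht1.eventually_ge_atTop 1] with n h1 h2
  have e4 : 2 * √(n * Real.log (Real.log n)) = √(4 * (n * Real.log (Real.log n))) := by
    rw [Real.sqrt_mul (x := 4) (by norm_num), show (4 : ℝ) = 2 ^ 2 by norm_num,
      Real.sqrt_sq (by norm_num)]
  rw [e4, lilScale]
  apply Real.sqrt_le_sqrt
  have : logScale n ≤ 4 * Real.log (Real.log n) := by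
    have : Real.log (1 + Real.log n) ≤ Real.log (2 * Real.log n) := by
      apply Real.log_le_log <;> linarith
    rw [Real.log_mul (by norm_num) (by linarith)] at this
    unfold logScale
    linarith [Real.log_two_lt_d9]
  have hn : (0 : ℝ) ≤ n := by positivity
  nlinarith

/-! ### A maximal inequality for sums of bounded independent variables -/

section Maximal

variable {Ω : Type*} [MeasurableSpace Ω] {P : Measure Ω}

lemma integrable_prod_range {W : ℕ → Ω → ℝ} (hW : iIndepFun W P)
    (hm : ∀ i, Measurable (W i)) (hint : ∀ i, Integrable (W i) P) (n : ℕ) :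
    Integrable (fun ω => ∏ i ∈ Finset.range n, W i ω) P := by
  have := hW.isProbabilityMeasure
  induction n with
  | zero => simp
  | succ n ih =>
    simp_rw [Finset.prod_range_succ]
    have h := hW.indepFun_finsetProd_of_notMem hm (s := Finset.range n) (i := n) (by simp)
    have e : (∏ j ∈ Finset.range n, W j) = fun ω => ∏ i ∈ Finset.range n, W i ω := by
      ext ω; simp
    rw [e] at h
    exact h.integrable_mul ih (hint n)

/-- Partial products of independent nonnegative variables of mean at least `1` form a
submartingale. -/
lemma submartingale_prod {W : ℕ → Ω → ℝ} (hW : iIndepFun W P) (hm : ∀ i, Measurable (W i))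
    (hint : ∀ i, Integrable (W i) P) (h0 : ∀ i ω, 0 ≤ W i ω) (h1 : ∀ i, 1 ≤ ∫ ω, W i ω ∂P) :
    Submartingale (fun n ω => ∏ i ∈ Finset.range (n + 1), W i ω)
      (Filtration.natural W fun i => (hm i).stronglyMeasurable) P := by
  have := hW.isProbabilityMeasure
  have had : StronglyAdapted (Filtration.natural W fun i => (hm i).stronglyMeasurable)
      (fun n ω => ∏ i ∈ Finset.range (n + 1), W i ω) := by
    intro n
    refine Finset.stronglyMeasurable_fun_prod _ fun i hi => ?_
    exact (Filtration.stronglyAdapted_natural (fun i => (hm i).stronglyMeasurable) i).mono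
      ((Filtration.natural W _).mono (by simpa [Nat.lt_succ_iff] using hi))
  refine submartingale_nat had (fun n => integrable_prod_range hW hm hint _) fun n => ?_
  have e : (fun ω => ∏ i ∈ Finset.range (n + 1 + 1), W i ω) =
      (fun ω => ∏ i ∈ Finset.range (n + 1), W i ω) * W (n + 1) := by
    ext ω; simp [Finset.prod_range_succ]
  have hp := condExp_mul_of_stronglyMeasurable_left (had n)
    (by rw [← e]; exact integrable_prod_range hW hm hint _) (hint (n + 1))
  have hq := hW.condExp_natural_ae_eq_of_lt (fun i => (hm i).stronglyMeasurable) n.lt_succ_self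
  rw [e]
  filter_upwards [hp, hq] with ω hp hq
  rw [hp, Pi.mul_apply, hq]
  exact le_mul_of_one_le_right (Finset.prod_nonneg fun i _ => h0 i ω) (h1 _)

/-- Exponential moments of a bounded centred variable: at least `1`, which makes products of such
exponentials submartingales, and at most `exp (t² v)` as long as `|t| * b ≤ 1`. -/
lemma integral_exp_mul_bounds [IsProbabilityMeasure P] {Y : Ω → ℝ} (hm : Measurable Y) {b : ℝ}
    (hb : ∀ ω, |Y ω| ≤ b) (hmean : ∫ ω, Y ω ∂P = 0) (t : ℝ) :
    Integrable (fun ω => Real.exp (t * Y ω)) P ∧ 1 ≤ ∫ ω, Real.exp (t * Y ω) ∂P ∧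
      (|t| * b ≤ 1 → ∀ v, ∫ ω, Y ω ^ 2 ∂P ≤ v →
        ∫ ω, Real.exp (t * Y ω) ∂P ≤ Real.exp (t ^ 2 * v)) := by
  have hYi : Integrable Y P := Integrable.of_bound hm.aestronglyMeasurable b
    (.of_forall fun ω => by simpa using hb ω)
  have hY2 : Integrable (fun ω => Y ω ^ 2) P :=
    Integrable.of_bound (hm.pow_const 2).aestronglyMeasurable (b ^ 2) (.of_forall fun ω => by
      have := pow_le_pow_left₀ (abs_nonneg _) (hb ω) 2
      simpa using this)
  have hE : Integrable (fun ω => Real.exp (t * Y ω)) P := by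
    refine Integrable.of_bound (by fun_prop) (Real.exp (|t| * b)) (.of_forall fun ω => ?_)
    rw [Real.norm_eq_abs, Real.abs_exp, Real.exp_le_exp]
    calc t * Y ω ≤ |t * Y ω| := le_abs_self _
      _ = |t| * |Y ω| := abs_mul _ _
      _ ≤ |t| * b := by gcongr; exact hb ω
  have hlin : ∫ ω, (1 + t * Y ω) ∂P = 1 := by
    rw [integral_add (integrable_const _) (hYi.const_mul t), integral_const_mul, hmean]
    simp
  refine ⟨hE, ?_, fun htb v hv => ?_⟩
  · rw [← hlin]
    refine integral_mono ((integrable_const _).add (hYi.const_mul t)) hE fun ω => ?_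
    have := Real.add_one_le_exp (t * Y ω)
    linarith
  · calc ∫ ω, Real.exp (t * Y ω) ∂P ≤ ∫ ω, ((1 + t * Y ω) + t ^ 2 * Y ω ^ 2) ∂P := by
          refine integral_mono hE (((integrable_const _).add (hYi.const_mul t)).add
            (hY2.const_mul _)) fun ω => ?_
          have h1 : |t * Y ω| ≤ 1 := by
            rw [abs_mul]
            exact (mul_le_mul_of_nonneg_left (hb ω) (abs_nonneg t)).trans htb
          have := (abs_le.1 (Real.abs_exp_sub_one_sub_id_le h1)).2
          nlinarith
      _ = 1 + t ^ 2 * ∫ ω, Y ω ^ 2 ∂P := by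
          have h1 : Integrable (fun ω => 1 + t * Y ω) P :=
            (integrable_const _).add (hYi.const_mul t)
          rw [integral_add h1 (hY2.const_mul _), hlin, integral_const_mul]
      _ ≤ t ^ 2 * v + 1 := by nlinarith [sq_nonneg t]
      _ ≤ Real.exp (t ^ 2 * v) := Real.add_one_le_exp _

/-- A Bernstein-type inequality for the running maximum of sums of independent, bounded, centred
variables, from Doob's maximal inequality for the exponential submartingale. -/
lemma measure_exists_sum_ge_le {X : ℕ → Ω → ℝ} (hX : iIndepFun X P)
    (hm : ∀ i, Measurable (X i)) {b : ℕ → ℝ} (hb : ∀ i ω, |X i ω| ≤ b i)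
    (hmean : ∀ i, ∫ ω, X i ω ∂P = 0) {v : ℝ} (hv : ∀ i, ∫ ω, X i ω ^ 2 ∂P ≤ v) {N : ℕ} {t s : ℝ}
    (ht : 0 ≤ t) (htb : ∀ i < N, t * b i ≤ 1) (hs : 0 < s) :
    P {ω | ∃ n ≤ N, s ≤ ∑ i ∈ Finset.range n, X i ω} ≤
      ENNReal.ofReal (Real.exp (-(t * s) + t ^ 2 * v * N)) := by
  have := hX.isProbabilityMeasure
  rcases Nat.eq_zero_or_pos N with rfl | hN
  · simp [hs.not_ge]
  obtain ⟨M, rfl⟩ : ∃ M, N = M + 1 := ⟨N - 1, by omega⟩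
  set W : ℕ → Ω → ℝ := fun i ω => Real.exp (t * X i ω) with hWdef
  have hWm : ∀ i, Measurable (W i) := fun i => ((hm i).const_mul t).exp
  have hWi : iIndepFun W P := hX.comp (fun _ x => Real.exp (t * x)) fun _ => by fun_prop
  have hB := fun i => integral_exp_mul_bounds (hm i) (hb i) (hmean i) t
  have hsub := submartingale_prod hWi hWm (fun i => (hB i).1) (fun i ω => (Real.exp_pos _).le)
    fun i => (hB i).2.1
  have hprod : ∀ n ω, ∏ i ∈ Finset.range n, W i ω
      = Real.exp (t * ∑ i ∈ Finset.range n, X i ω) := fun n ω => by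
    rw [Finset.mul_sum, Real.exp_sum]
  have hdoob := maximal_ineq hsub (fun n ω => Finset.prod_nonneg fun i _ => (Real.exp_pos _).le)
    (ε := (Real.exp (t * s)).toNNReal) M
  rw [Real.coe_toNNReal _ (Real.exp_pos _).le] at hdoob
  have hint : ∫ ω, ∏ i ∈ Finset.range (M + 1), W i ω ∂P ≤ Real.exp (t ^ 2 * v * (M + 1 : ℕ)) := by
    calc ∫ ω, ∏ i ∈ Finset.range (M + 1), W i ω ∂P
        = mgf (∑ i ∈ Finset.range (M + 1), X i) P t := by simp only [hprod, mgf, Finset.sum_apply]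
      _ = ∏ i ∈ Finset.range (M + 1), mgf (X i) P t := hX.mgf_sum hm _
      _ ≤ ∏ _i ∈ Finset.range (M + 1), Real.exp (t ^ 2 * v) := by
          refine Finset.prod_le_prod (fun i _ => mgf_nonneg) fun i hi => (hB i).2.2 ?_ v (hv i)
          rw [abs_of_nonneg ht]
          exact htb i (Finset.mem_range.1 hi)
      _ = Real.exp (t ^ 2 * v * (M + 1 : ℕ)) := by
          rw [Finset.prod_const, Finset.card_range, ← Real.exp_nat_mul, mul_comm]
  set A : Set Ω := {ω | Real.exp (t * s) ≤ (Finset.range (M + 1)).sup'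
    Finset.nonempty_range_add_one fun k => ∏ i ∈ Finset.range (k + 1), W i ω}
  have hsubset : {ω | ∃ n ≤ M + 1, s ≤ ∑ i ∈ Finset.range n, X i ω} ⊆ A := by
    rintro ω ⟨n, hn, hsn⟩
    obtain ⟨k, rfl⟩ : ∃ k, n = k + 1 := by
      refine ⟨n - 1, ?_⟩
      rcases Nat.eq_zero_or_pos n with rfl | h
      · exact absurd hsn (by simpa using hs)
      · omega
    have hk : Real.exp (t * s) ≤ ∏ i ∈ Finset.range (k + 1), W i ω := by
      rw [hprod, Real.exp_le_exp]
      gcongr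
    exact hk.trans (Finset.le_sup' (fun k => ∏ i ∈ Finset.range (k + 1), W i ω)
      (Finset.mem_range.2 (by omega)))
  have hdoob' : ENNReal.ofReal (Real.exp (t * s)) * P A ≤
      ENNReal.ofReal (Real.exp (t ^ 2 * v * (M + 1 : ℕ))) := by
    refine hdoob.trans (ENNReal.ofReal_le_ofReal (le_trans ?_ hint))
    exact setIntegral_le_integral (hsub.integrable M)
      (.of_forall fun ω => Finset.prod_nonneg fun i _ => (Real.exp_pos _).le)
  refine (measure_mono hsubset).trans ?_
  have hpos : ENNReal.ofReal (Real.exp (t * s)) ≠ 0 := by simp [Real.exp_pos]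
  rw [Real.exp_add, Real.exp_neg, ENNReal.ofReal_mul (by positivity),
    ENNReal.ofReal_inv_of_pos (Real.exp_pos _), mul_comm _⁻¹, ← div_eq_mul_inv,
    ENNReal.le_div_iff_mul_le (Or.inl hpos) (Or.inl ENNReal.ofReal_ne_top), mul_comm]
  exact hdoob'

end Maximal

/-! ### The upper bound of the law of the iterated logarithm -/

section IteratedLogarithm

variable {Ω : Type*} [MeasurableSpace Ω] {P : Measure Ω}

/-- The bounded part of the law of the iterated logarithm: Borel-Cantelli along dyadic blocks. -/
lemma ae_eventually_sum_le_of_bounded {X : ℕ → Ω → ℝ} (hX : iIndepFun X P)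
    (hm : ∀ i, Measurable (X i)) (hb : ∀ i ω, |X i ω| ≤ 2 * truncLevel (i + 1))
    (hmean : ∀ i, ∫ ω, X i ω ∂P = 0) {v : ℝ} (hv : ∀ i, ∫ ω, X i ω ^ 2 ∂P ≤ v) :
    ∀ᵐ ω ∂P, ∀ᶠ n in atTop, ∑ i ∈ Finset.range n, X i ω ≤ (8 + v) * lilScale n := by
  have hv0 : 0 ≤ v := (integral_nonneg fun ω => sq_nonneg (X 0 ω)).trans (hv 0)
  set S : ℕ → Set Ω := fun k => {ω | ∃ n ≤ 2 ^ (k + 1),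
    (4 + v / 2) * lilScale (2 ^ (k + 1)) ≤ ∑ i ∈ Finset.range n, X i ω}
  have hS : ∀ k, P (S k) ≤ ENNReal.ofReal (Real.exp (-2 * logScale (2 ^ (k + 1)))) := by
    intro k
    have hN : 0 < 2 ^ (k + 1) := by positivity
    have ha := truncLevel_pos hN
    have hl := lilScale_pos hN
    have hL := logScale_pos (2 ^ (k + 1))
    -- the largest exponent for which the exponents `t * X i` stay below `1`
    have h := measure_exists_sum_ge_le hX hm hb hmean hv (N := 2 ^ (k + 1))
      (t := 1 / (2 * truncLevel (2 ^ (k + 1)))) (s := (4 + v / 2) * lilScale (2 ^ (k + 1)))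
      (by positivity) (fun i hi => by
        have := truncLevel_mono (Nat.succ_le_of_lt hi)
        simp only [Nat.succ_eq_add_one] at this
        rw [one_div_mul_eq_div, div_le_one (by positivity)]
        linarith) (by positivity)
    refine h.trans (ENNReal.ofReal_le_ofReal (Real.exp_le_exp.2 ?_))
    have hsq := truncLevel_sq (2 ^ (k + 1))
    rw [lilScale_eq]
    have e1 : 1 / (2 * truncLevel (2 ^ (k + 1))) *
        ((4 + v / 2) * (truncLevel (2 ^ (k + 1)) * logScale (2 ^ (k + 1)))) =
        (2 + v / 4) * logScale (2 ^ (k + 1)) := by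
      field_simp; ring
    have e2 : (1 / (2 * truncLevel (2 ^ (k + 1)))) ^ 2 * v * ((2 ^ (k + 1) : ℕ) : ℝ) =
        v / 4 * logScale (2 ^ (k + 1)) := by
      have hN' : (0 : ℝ) < ((2 ^ (k + 1) : ℕ) : ℝ) := by exact_mod_cast hN
      rw [div_pow, mul_pow, hsq]
      field_simp; ring
    rw [e1, e2]
    linarith
  have hsum : ∑' k, P (S k) ≠ ⊤ := by
    refine ne_top_of_le_ne_top ?_ (ENNReal.tsum_le_tsum hS)
    rw [← ENNReal.ofReal_tsum_of_nonneg (fun _ => (Real.exp_pos _).le)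
      summable_exp_neg_two_mul_logScale]
    exact ENNReal.ofReal_ne_top
  filter_upwards [ae_eventually_notMem hsum] with ω hω
  -- `n` lies in the block between `2 ^ k` and `2 ^ (k + 1)`, along which `lilScale` at most doubles
  obtain ⟨k₀, hk₀⟩ := eventually_atTop.1 hω
  filter_upwards [eventually_ge_atTop (2 ^ k₀)] with n hn
  have hn0 : n ≠ 0 := (Nat.two_pow_pos k₀ |>.trans_le hn).ne'
  have hk : k₀ ≤ Nat.log 2 n := Nat.le_log_of_pow_le (by norm_num) hn
  have hlt : n < 2 ^ (Nat.log 2 n + 1) := Nat.lt_pow_succ_log_self (by norm_num) n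
  have hle : 2 ^ Nat.log 2 n ≤ n := Nat.pow_log_le_self 2 hn0
  have h := hk₀ _ hk
  simp only [S, Set.mem_ofPred_eq, not_exists, not_and, not_le] at h
  have h1 := h n hlt.le
  have h2 := lilScale_two_pow_succ_le (Nat.log 2 n)
  have h3 := lilScale_mono hle
  calc ∑ i ∈ Finset.range n, X i ω ≤ (4 + v / 2) * lilScale (2 ^ (Nat.log 2 n + 1)) := h1.le
    _ ≤ (4 + v / 2) * (2 * lilScale n) := by gcongr; linarith
    _ = (8 + v) * lilScale n := by ring

/-- The part of `x` beyond the truncation level of index `i + 1`. -/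
noncomputable def tailPart (i : ℕ) (x : ℝ) : ℝ := if truncLevel (i + 1) < |x| then x else 0

lemma measurable_tailPart (i : ℕ) : Measurable (tailPart i) :=
  Measurable.ite (measurableSet_lt measurable_const measurable_abs) measurable_id measurable_const

lemma abs_tailPart_le (i : ℕ) (x : ℝ) : |tailPart i x| ≤ |x| := by
  unfold tailPart; split_ifs <;> simp

lemma abs_sub_tailPart_le_abs (i : ℕ) (x : ℝ) : |x - tailPart i x| ≤ |x| := by
  unfold tailPart; split_ifs <;> simp

lemma abs_sub_tailPart_le (i : ℕ) (x : ℝ) : |x - tailPart i x| ≤ truncLevel (i + 1) := by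
  unfold tailPart
  split_ifs with h
  · simpa using truncLevel_nonneg _
  · simpa using h

lemma sum_tailPart_div_le (x : ℝ) (n : ℕ) :
    ∑ i ∈ Finset.range n, |tailPart i x| / lilScale (i + 1) ≤ 4 * x ^ 2 := by
  have h := sum_indicator_truncLevel_le (abs_nonneg x) n
  calc ∑ i ∈ Finset.range n, |tailPart i x| / lilScale (i + 1)
      = |x| * ∑ i ∈ Finset.range n,
          (if truncLevel (i + 1) < |x| then 1 / lilScale (i + 1) else 0) := by
        rw [Finset.mul_sum]
        refine Finset.sum_congr rfl fun i _ => ?_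
        unfold tailPart
        split_ifs <;> simp [div_eq_mul_inv]
    _ ≤ |x| * (4 * |x|) := by gcongr
    _ = 4 * x ^ 2 := by rw [← sq_abs x]; ring

lemma sum_le_of_sum_div_lilScale_le {y : ℕ → ℝ} (hy : ∀ i, 0 ≤ y i) {K : ℝ} {n : ℕ}
    (h : ∑ i ∈ Finset.range n, y i / lilScale (i + 1) ≤ K) :
    ∑ i ∈ Finset.range n, y i ≤ K * lilScale n := by
  have hn := lilScale_nonneg n
  calc ∑ i ∈ Finset.range n, y i
      ≤ ∑ i ∈ Finset.range n, y i / lilScale (i + 1) * lilScale n := by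
        refine Finset.sum_le_sum fun i hi => ?_
        have h1 := lilScale_pos i.succ_pos
        have h2 := lilScale_mono (Nat.succ_le_of_lt (Finset.mem_range.1 hi))
        simp only [Nat.succ_eq_add_one] at h1 h2
        rw [div_mul_eq_mul_div, le_div_iff₀ h1]
        exact mul_le_mul_of_nonneg_left h2 (hy i)
    _ ≤ K * lilScale n := by rw [← Finset.sum_mul]; gcongr

lemma sum_integral_abs_tailPart_le {X : ℕ → Ω → ℝ} [IsFiniteMeasure P]
    (hid : ∀ i, IdentDistrib (X i) (X 0) P P) (h2 : MemLp (X 0) 2 P) (n : ℕ) :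
    ∑ i ∈ Finset.range n, ∫ ω, |tailPart i (X i ω)| ∂P ≤
      (4 * ∫ ω, X 0 ω ^ 2 ∂P) * lilScale n := by
  refine sum_le_of_sum_div_lilScale_le (fun i => integral_nonneg fun ω => abs_nonneg _) ?_
  have hm0 : AEMeasurable (X 0) P := (hid 0).aemeasurable_fst
  have hint : ∀ i, Integrable (fun ω => |tailPart i (X 0 ω)| / lilScale (i + 1)) P := fun i => by
    refine Integrable.div_const ?_ _
    refine (h2.integrable one_le_two).abs.mono
      (((measurable_tailPart i).comp_aemeasurable hm0).abs.aestronglyMeasurable)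
      (.of_forall fun ω => ?_)
    simpa using abs_tailPart_le i (X 0 ω)
  calc ∑ i ∈ Finset.range n, (∫ ω, |tailPart i (X i ω)| ∂P) / lilScale (i + 1)
      = ∑ i ∈ Finset.range n, ∫ ω, |tailPart i (X 0 ω)| / lilScale (i + 1) ∂P := by
        refine Finset.sum_congr rfl fun i _ => ?_
        rw [integral_div]
        congr 1
        exact ((hid i).comp (measurable_tailPart i).abs).integral_eq
    _ = ∫ ω, ∑ i ∈ Finset.range n, |tailPart i (X 0 ω)| / lilScale (i + 1) ∂P :=
        (integral_finsetSum _ fun i _ => hint i).symm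
    _ ≤ ∫ ω, 4 * X 0 ω ^ 2 ∂P :=
        integral_mono (integrable_finsetSum _ fun i _ => hint i) (h2.integrable_sq.const_mul 4)
          fun ω => sum_tailPart_div_le _ _
    _ = 4 * ∫ ω, X 0 ω ^ 2 ∂P := integral_const_mul _ _

/-- The variables beyond the truncation level contribute, almost surely, at most a multiple of
`lilScale`: their weighted sum has finite expectation. -/
lemma ae_exists_sum_abs_tailPart_le {X : ℕ → Ω → ℝ}
    (hid : ∀ i, IdentDistrib (X i) (X 0) P P) (h2 : MemLp (X 0) 2 P) :
    ∀ᵐ ω ∂P, ∃ K, ∀ n, ∑ i ∈ Finset.range n, |tailPart i (X i ω)| ≤ K * lilScale n := by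
  set g : ℕ → ℝ → ENNReal := fun i x => ENNReal.ofReal (|tailPart i x| / lilScale (i + 1))
  have hg : ∀ i, Measurable (g i) := fun i =>
    ((measurable_tailPart i).abs.div_const _).ennreal_ofReal
  have hgX : ∀ i j, AEMeasurable (fun ω => g i (X j ω)) P := fun i j =>
    (hg i).comp_aemeasurable (hid j).aemeasurable_fst
  have hfin : ∫⁻ ω, ∑' i, g i (X i ω) ∂P ≠ ⊤ := by
    rw [lintegral_tsum fun i => hgX i i]
    have e : ∀ i, ∫⁻ ω, g i (X i ω) ∂P = ∫⁻ ω, g i (X 0 ω) ∂P := fun i =>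
      ((hid i).comp (hg i)).lintegral_eq
    simp_rw [e]
    rw [← lintegral_tsum fun i => hgX i 0]
    refine ne_top_of_le_ne_top ?_ (lintegral_mono (g := fun ω => ENNReal.ofReal (4 * X 0 ω ^ 2))
      fun ω => ?_)
    · exact (h2.integrable_sq.const_mul 4).lintegral_lt_top.ne
    · refine ENNReal.tsum_le_of_sum_range_le fun n => ?_
      rw [← ENNReal.ofReal_sum_of_nonneg
        fun i _ => div_nonneg (abs_nonneg _) (lilScale_nonneg _)]
      exact ENNReal.ofReal_le_ofReal (sum_tailPart_div_le _ _)
  filter_upwards [ae_lt_top' (AEMeasurable.tsum fun i => hgX i i) hfin] with ω hω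
  refine ⟨(∑' i, g i (X i ω)).toReal, fun n => ?_⟩
  refine sum_le_of_sum_div_lilScale_le (fun i => abs_nonneg _) ?_
  rw [← ENNReal.ofReal_le_iff_le_toReal hω.ne, ENNReal.ofReal_sum_of_nonneg
    fun i _ => div_nonneg (abs_nonneg _) (lilScale_nonneg _)]
  exact ENNReal.sum_le_tsum _

/-- One-sided upper bound of the law of the iterated logarithm. -/
lemma ae_exists_eventually_sum_le {X : ℕ → Ω → ℝ} (hX : iIndepFun X P)
    (hm : ∀ i, Measurable (X i)) (hid : ∀ i, IdentDistrib (X i) (X 0) P P)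
    (h2 : MemLp (X 0) 2 P) (h0 : ∫ ω, X 0 ω ∂P = 0) :
    ∀ᵐ ω ∂P, ∃ K, ∀ᶠ n in atTop, ∑ i ∈ Finset.range n, X i ω ≤ K * lilScale n := by
  have := hX.isProbabilityMeasure
  have hXi : ∀ i, Integrable (X i) P := fun i =>
    ((hid i).integrable_iff).2 (h2.integrable one_le_two)
  have hX2 : ∀ i, Integrable (fun ω => X i ω ^ 2) P := fun i =>
    ((hid i).memLp_iff.2 h2).integrable_sq
  have htm : ∀ i, Measurable fun ω => tailPart i (X i ω) := fun i =>
    (measurable_tailPart i).comp (hm i)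
  have hti : ∀ i, Integrable (fun ω => tailPart i (X i ω)) P := fun i =>
    (hXi i).mono (htm i).aestronglyMeasurable (.of_forall fun ω => abs_tailPart_le i (X i ω))
  -- the truncated variables, centred
  set m : ℕ → ℝ := fun i => ∫ ω, tailPart i (X i ω) ∂P
  set U : ℕ → Ω → ℝ := fun i ω => X i ω - tailPart i (X i ω) with hU
  have hUm : ∀ i, Measurable (U i) := fun i => (hm i).sub (htm i)
  have hUi : ∀ i, Integrable (U i) P := fun i => (hXi i).sub (hti i)
  have hUmean : ∀ i, ∫ ω, U i ω ∂P = -m i := fun i => by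
    rw [integral_sub (hXi i) (hti i), (hid i).integral_eq, h0, zero_sub]
  have hUb : ∀ i ω, |U i ω| ≤ truncLevel (i + 1) := fun i ω => abs_sub_tailPart_le _ _
  have hmb : ∀ i, |m i| ≤ truncLevel (i + 1) := fun i => by
    rw [← abs_neg, ← hUmean]
    have := norm_integral_le_of_norm_le_const (μ := P) (f := U i) (C := truncLevel (i + 1))
      (.of_forall fun ω => by simpa using hUb i ω)
    simpa using this
  have hU2 : ∀ i, Integrable (fun ω => U i ω ^ 2) P := fun i =>
    (hX2 i).mono ((hUm i).pow_const 2).aestronglyMeasurable (.of_forall fun ω => by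
      have := pow_le_pow_left₀ (abs_nonneg _) (abs_sub_tailPart_le_abs i (X i ω)) 2
      simpa [hU] using this)
  have hmain := ae_eventually_sum_le_of_bounded (P := P) (X := fun i ω => U i ω + m i)
    (hX.comp (fun i x => x - tailPart i x + m i)
      fun i => (measurable_id.sub (measurable_tailPart i)).add_const _)
    (fun i => (hUm i).add_const _)
    (fun i ω => (abs_add_le _ _).trans (by linarith [hUb i ω, hmb i]))
    (fun i => by rw [integral_add (hUi i) (integrable_const _), hUmean]; simp)
    (v := ∫ ω, X 0 ω ^ 2 ∂P) (fun i => by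
      have e1 : ∫ ω, (U i ω + m i) ^ 2 ∂P = ∫ ω, U i ω ^ 2 ∂P - m i ^ 2 := by
        have : ∀ ω, (U i ω + m i) ^ 2 = U i ω ^ 2 + (2 * m i * U i ω + m i ^ 2) := fun ω => by ring
        simp_rw [this]
        have h1 : Integrable (fun ω => 2 * m i * U i ω) P := (hUi i).const_mul _
        have h3 : Integrable (fun ω => 2 * m i * U i ω + m i ^ 2) P := h1.add (integrable_const _)
        rw [integral_add (hU2 i) h3, integral_add h1 (integrable_const _), integral_const_mul,
          hUmean]
        simp; ring
      have e2 : ∫ ω, U i ω ^ 2 ∂P ≤ ∫ ω, X i ω ^ 2 ∂P :=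
        integral_mono (hU2 i) (hX2 i) fun ω => sq_le_sq.2 (abs_sub_tailPart_le_abs _ _)
      have e3 : ∫ ω, X i ω ^ 2 ∂P = ∫ ω, X 0 ω ^ 2 ∂P :=
        ((hid i).comp (u := fun x : ℝ => x ^ 2) (by fun_prop)).integral_eq
      rw [e1, ← e3]
      linarith [sq_nonneg (m i)])
  filter_upwards [hmain, ae_exists_sum_abs_tailPart_le hid h2] with ω h1 ⟨K, hK⟩
  refine ⟨8 + ∫ ω, X 0 ω ^ 2 ∂P + K + 4 * ∫ ω, X 0 ω ^ 2 ∂P, ?_⟩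
  filter_upwards [h1] with n hn
  have hK1 : ∑ i ∈ Finset.range n, tailPart i (X i ω) ≤ K * lilScale n :=
    (Finset.sum_le_sum fun i _ => le_abs_self _).trans (hK n)
  have hK2 : ∑ i ∈ Finset.range n, -m i ≤ (4 * ∫ ω, X 0 ω ^ 2 ∂P) * lilScale n :=
    (Finset.sum_le_sum fun i _ => (neg_le_abs _).trans
      abs_integral_le_integral_abs).trans (sum_integral_abs_tailPart_le hid h2 n)
  calc ∑ i ∈ Finset.range n, X i ω
      = ∑ i ∈ Finset.range n, (U i ω + m i) + ∑ i ∈ Finset.range n, tailPart i (X i ω)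
        + ∑ i ∈ Finset.range n, -m i := by
        rw [← Finset.sum_add_distrib, ← Finset.sum_add_distrib]
        exact Finset.sum_congr rfl fun i _ => by simp only [hU]; ring
    _ ≤ _ := by linarith

/-- Upper bound of the law of the iterated logarithm of Hartman and Wintner, up to the constant. -/
theorem ae_sum_isBigO_sqrt_mul_log_log {X : ℕ → Ω → ℝ} (hX : iIndepFun X P)
    (hm : ∀ i, Measurable (X i)) (hid : ∀ i, IdentDistrib (X i) (X 0) P P)
    (h2 : MemLp (X 0) 2 P) (h0 : ∫ ω, X 0 ω ∂P = 0) :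
    ∀ᵐ ω ∂P, (fun n : ℕ => ∑ i ∈ Finset.range n, X i ω) =O[atTop]
      fun n : ℕ => √(n * Real.log (Real.log n)) := by
  have hneg := ae_exists_eventually_sum_le (X := fun i ω => -X i ω)
    (hX.comp (fun _ x => -x) fun _ => measurable_neg) (fun i => (hm i).neg)
    (fun i => (hid i).comp measurable_neg) h2.neg (by rw [integral_neg, h0, neg_zero])
  filter_upwards [ae_exists_eventually_sum_le hX hm hid h2 h0, hneg] with ω ⟨K₁, h₁⟩ ⟨K₂, h₂⟩
  refine Asymptotics.IsBigO.of_bound (2 * max (max K₁ K₂) 0) ?_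
  filter_upwards [h₁, h₂, eventually_lilScale_le] with n h₁ h₂ h₃
  rw [Finset.sum_neg_distrib] at h₂
  have hl := lilScale_nonneg n
  have hK : 0 ≤ max (max K₁ K₂) 0 := le_max_right _ _
  have hb : |∑ i ∈ Finset.range n, X i ω| ≤ max (max K₁ K₂) 0 * lilScale n := by
    refine abs_le'.2 ⟨h₁.trans ?_, h₂.trans ?_⟩
    · gcongr; exact (le_max_left _ _).trans (le_max_left _ _)
    · gcongr; exact (le_max_right _ _).trans (le_max_left _ _)
  rw [Real.norm_eq_abs, Real.norm_of_nonneg (Real.sqrt_nonneg _)]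
  calc _ ≤ _ := hb
    _ ≤ max (max K₁ K₂) 0 * (2 * √(n * Real.log (Real.log n))) := by gcongr
    _ = _ := by ring

end IteratedLogarithm

/-! ### Extended-real convex functions, positive operators and pseudo-inverses -/

section ConvexAnalysis

variable {p : ℕ} {R : Vec p → EReal}

lemma mem_subdiff_iff {w : Vec p} {r : ℝ} (hr : R w = r) {η : Vec p} :
    η ∈ subdiff R w ↔ ∀ v, ((r + inner ℝ η (v - w) : ℝ) : EReal) ≤ R v := by
  simp only [subdiff, hr, Set.mem_ofPred_eq, EReal.coe_add]

lemma isClosed_subdiff {w : Vec p} {r : ℝ} (hr : R w = r) : IsClosed (subdiff R w) := by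
  have e : subdiff R w = ⋂ v, {η | ((r + inner ℝ η (v - w) : ℝ) : EReal) ≤ R v} := by
    ext η; simp [mem_subdiff_iff hr]
  rw [e]
  exact isClosed_iInter fun v => isClosed_le
    (continuous_coe_real_ereal.comp (by fun_prop)) continuous_const

lemma convex_subdiff {w : Vec p} {r : ℝ} (hr : R w = r) : Convex ℝ (subdiff R w) := by
  intro η hη ζ hζ a b ha hb hab
  rw [mem_subdiff_iff hr] at hη hζ ⊢
  intro v
  refine le_trans ?_ (max_le (hη v) (hζ v))
  rw [← EReal.coe_strictMono.monotone.map_max, EReal.coe_le_coe_iff, inner_add_left,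
    inner_smul_left, inner_smul_left]
  simp only [conj_trivial]
  calc r + (a * inner ℝ η (v - w) + b * inner ℝ ζ (v - w))
      = a * (r + inner ℝ η (v - w)) + b * (r + inner ℝ ζ (v - w)) := by
        linear_combination (-r) * hab
    _ ≤ a * max (r + inner ℝ η (v - w)) (r + inner ℝ ζ (v - w)) +
        b * max (r + inner ℝ η (v - w)) (r + inner ℝ ζ (v - w)) := by
        gcongr
        · exact le_max_left _ _
        · exact le_max_right _ _
    _ = _ := by rw [← add_mul, hab, one_mul]

/-- Convexity of `R` along a segment, in terms of real upper bounds for `R` at its ends. -/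
lemma IsConvex.le_of_le (hconv : IsConvex R) {w v : Vec p} {a b : ℝ} (ha : R w ≤ a) (hb : R v ≤ b)
    {t : ℝ} (ht0 : 0 ≤ t) (ht1 : t ≤ 1) :
    R (w + t • (v - w)) ≤ ((a + t * (b - a) : ℝ) : EReal) := by
  have h := hconv (x := (w, a)) ha (y := (v, b)) hb (sub_nonneg.2 ht1) ht0 (by ring)
  have e1 : (1 - t) • w + t • v = w + t • (v - w) := by module
  have e2 : (1 - t) * a + t * b = a + t * (b - a) := by ring
  simpa [e1, e2] using h

/-- A real upper bound for the values of a lower semicontinuous function passes to the limit. -/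
lemma le_of_tendsto_of_frequently_le (hlsc : LowerSemicontinuous R) {ι : Type*} {l : Filter ι}
    {w : ι → Vec p} {w₀ : Vec p} (hw : Tendsto w l (𝓝 w₀)) {b : ι → ℝ} {b₀ : ℝ}
    (hb : Tendsto b l (𝓝 b₀)) (h : ∃ᶠ i in l, R (w i) ≤ b i) : R w₀ ≤ b₀ := by
  by_contra! hlt
  obtain ⟨c, hc1, hc2⟩ := EReal.lt_iff_exists_real_btwn.1 hlt
  obtain ⟨i, h1, h2, h3⟩ := (h.and_eventually ((hw.eventually (hlsc w₀ c hc2)).and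
    (hb.eventually_lt_const (EReal.coe_lt_coe_iff.1 hc1)))).exists
  exact absurd (h2.trans_le h1) (not_lt.2 (EReal.coe_le_coe_iff.2 h3.le))

/-- Uniqueness of the minimizer of `R` over `w₀ + Vᗮ` gives growth in all directions: if `R` exceeds
`R w₀` by at most `B` at `w₀ + v`, and the component of `v` in `V` is at most `B`, then
`v` is small or is controlled linearly by `B`. -/
lemma exists_growth (hlsc : LowerSemicontinuous R) (hconv : IsConvex R) {w₀ : Vec p} {r₀ : ℝ}
    (hr : R w₀ = r₀) (V : Submodule ℝ (Vec p))
    (huniq : ∀ v ∈ Vᗮ, R (w₀ + v) ≤ r₀ → v = 0) {δ : ℝ} (hδ : 0 < δ) :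
    ∃ α > 0, ∀ v B, δ ≤ ‖v‖ → ‖V.starProjection v‖ ≤ B →
      R (w₀ + v) ≤ ((r₀ + B : ℝ) : EReal) → α * ‖v‖ < δ * B := by
  have key : ∃ α > 0, ∀ v, ‖v‖ = δ → ‖V.starProjection v‖ ≤ α →
      ¬ R (w₀ + v) ≤ ((r₀ + α : ℝ) : EReal) := by
    by_contra! hcon
    have hpos : ∀ k : ℕ, (0 : ℝ) < 1 / ((k : ℝ) + 1) := fun k => Nat.one_div_pos_of_nat
    choose v hv1 hv2 hv3 using fun k : ℕ => hcon (1 / ((k : ℝ) + 1)) (hpos k)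
    obtain ⟨z, hz, φ, hφ, hlim⟩ := (isCompact_sphere (0 : Vec p) δ).tendsto_subseq
      (x := v) (fun k => by simpa using hv1 k)
    have hε : Tendsto (fun k => 1 / ((φ k : ℝ) + 1)) atTop (𝓝 0) :=
      tendsto_one_div_add_atTop_nhds_zero_nat.comp hφ.tendsto_atTop
    have hP : V.starProjection z = 0 := by
      have h1 : Tendsto (fun k => V.starProjection (v (φ k))) atTop (𝓝 (V.starProjection z)) :=
        (V.starProjection.continuous.tendsto z).comp hlim
      exact tendsto_nhds_unique h1 (squeeze_zero_norm (fun k => hv2 (φ k)) hε)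
    have hzK : z ∈ Vᗮ := by
      have := Submodule.sub_starProjection_mem_orthogonal (K := V) z
      rwa [hP, sub_zero] at this
    have hRz : R (w₀ + z) ≤ r₀ := by
      refine le_of_tendsto_of_frequently_le hlsc (w := fun k => w₀ + v (φ k))
        (tendsto_const_nhds.add hlim) (b := fun k => r₀ + 1 / ((φ k : ℝ) + 1))
        (by simpa using tendsto_const_nhds.add hε) (Frequently.of_forall fun k => hv3 (φ k))
    have := huniq z hzK hRz
    simp [this] at hz
    exact hδ.ne hz
  obtain ⟨α, hα, h⟩ := key
  refine ⟨α, hα, fun v B hv hPv hRv => ?_⟩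
  by_contra! hle
  have hv0 : 0 < ‖v‖ := hδ.trans_le hv
  -- shrink `v` to the sphere of radius `δ`
  have ht0 : 0 ≤ δ / ‖v‖ := by positivity
  have hB : δ / ‖v‖ * B ≤ α := by rw [div_mul_eq_mul_div, div_le_iff₀ hv0]; exact hle
  refine h ((δ / ‖v‖) • v) ?_ ?_ ?_
  · rw [norm_smul, Real.norm_of_nonneg ht0, div_mul_cancel₀ _ hv0.ne']
  · rw [map_smul, norm_smul, Real.norm_of_nonneg ht0]
    exact (mul_le_mul_of_nonneg_left hPv ht0).trans hB
  · have := hconv.le_of_le hr.le hRv ht0 ((div_le_one hv0).2 hv)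
    rw [add_sub_cancel_left, add_sub_cancel_left] at this
    exact this.trans (EReal.coe_le_coe_iff.2 (by linarith))

section Linear

variable {C : Vec p →ₗ[ℝ] Vec p}

lemma inner_map_add_smul (hC : C.IsSymmetric) (w h : Vec p) (t : ℝ) :
    inner ℝ (C (w + t • h)) (w + t • h) =
      inner ℝ (C w) w + 2 * t * inner ℝ (C w) h + t ^ 2 * inner ℝ (C h) h := by
  have e : inner ℝ (C h) w = inner ℝ (C w) h := by rw [hC h w, real_inner_comm]
  simp only [map_add, map_smul, inner_add_left, inner_add_right, inner_smul_left, inner_smul_right,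
    conj_trivial, e]
  ring

lemma map_eq_zero_of_inner_eq_zero (hC : C.IsPositive) {v : Vec p} (hv : inner ℝ (C v) v = 0) :
    C v = 0 := by
  by_contra hne
  have hpos : 0 < ‖C v‖ ^ 2 := by positivity
  have hb : 0 ≤ inner ℝ (C (C v)) (C v) := hC.inner_nonneg_left (C v)
  -- the quadratic form would be negative at `v - t • C v` for small `t > 0`
  set b := inner ℝ (C (C v)) (C v) with hbdef
  have h := hC.inner_nonneg_left (v + (-(‖C v‖ ^ 2 / (b + 1))) • C v)
  rw [inner_map_add_smul hC.isSymmetric, hv, real_inner_self_eq_norm_sq, ← hbdef] at h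
  set a := ‖C v‖ ^ 2
  have : 0 + 2 * -(a / (b + 1)) * a + (-(a / (b + 1))) ^ 2 * b =
      -(a ^ 2 * (b + 2) / (b + 1) ^ 2) := by
    field_simp; ring
  rw [this] at h
  have : 0 < a ^ 2 * (b + 2) / (b + 1) ^ 2 := by positivity
  linarith

lemma map_eq_map_starProjection_range (hC : C.IsSymmetric) {A : Vec p →ₗ[ℝ] Vec p}
    (hA : LinearMap.ker C ≤ LinearMap.ker A) (v : Vec p) :
    A ((LinearMap.range C).starProjection v) = A v := by
  have h := Submodule.sub_starProjection_mem_orthogonal (K := LinearMap.range C) v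
  rw [hC.orthogonal_range] at h
  have := hA h
  rw [LinearMap.mem_ker, map_sub, sub_eq_zero] at this
  exact this.symm

lemma inner_starProjection_right {V : Submodule ℝ (Vec p)} {x : Vec p} (hx : x ∈ V) (v : Vec p) :
    inner ℝ x (V.starProjection v) = inner ℝ x v := by
  have h := Submodule.starProjection_inner_eq_zero (K := V) v x hx
  rw [real_inner_comm, inner_sub_right, sub_eq_zero] at h
  exact h.symm

/-- A positive operator is coercive on its range. -/
lemma exists_coercive (hC : C.IsPositive) :
    ∃ c > 0, ∀ v ∈ LinearMap.range C, c * ‖v‖ ^ 2 ≤ inner ℝ (C v) v := by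
  set S : Set (Vec p) := Metric.sphere 0 1 ∩ (LinearMap.range C : Set (Vec p))
  have hS : IsCompact S := (isCompact_sphere _ _).inter_right
    (Submodule.closed_of_finiteDimensional _)
  have hcont : Continuous fun v : Vec p => (inner ℝ (C v) v : ℝ) :=
    (LinearMap.continuous_of_finiteDimensional C).inner continuous_id
  obtain ⟨c, hc, h⟩ : ∃ c > 0, ∀ v ∈ S, c ≤ (inner ℝ (C v) v : ℝ) := by
    rcases S.eq_empty_or_nonempty with hE | hne
    · exact ⟨1, one_pos, by simp [hE]⟩
    obtain ⟨z, hz, hmin⟩ := hS.exists_isMinOn hne hcont.continuousOn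
    refine ⟨_, lt_of_le_of_ne (hC.inner_nonneg_left z) fun h0 => ?_, fun v hv => hmin hv⟩
    have hker : z ∈ (LinearMap.range C)ᗮ := by
      rw [hC.isSymmetric.orthogonal_range]
      exact map_eq_zero_of_inner_eq_zero hC h0.symm
    have : z = 0 := inner_self_eq_zero.1 (Submodule.inner_right_of_mem_orthogonal hz.2 hker)
    simpa [this] using hz.1
  refine ⟨c, hc, fun v hv => ?_⟩
  rcases eq_or_ne v 0 with rfl | hv0
  · simp
  have hn : 0 < ‖v‖ := norm_pos_iff.2 hv0
  have h1 := h (‖v‖⁻¹ • v) ⟨by simp [norm_smul, hn.ne'], Submodule.smul_mem _ _ hv⟩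
  rw [map_smul, inner_smul_left, inner_smul_right, conj_trivial] at h1
  have e : inner ℝ (C v) v = (‖v‖⁻¹ * (‖v‖⁻¹ * inner ℝ (C v) v)) * ‖v‖ ^ 2 := by field_simp
  rw [e]
  gcongr

lemma pinv_mem_range (hC : C.IsSymmetric) (η : Vec p) : pinv C η ∈ LinearMap.range C := by
  have h : pinv C η ∈ (LinearMap.ker C)ᗮ := Subtype.property _
  rwa [← hC.orthogonal_range, Submodule.orthogonal_orthogonal] at h

lemma map_pinv {η : Vec p} (hη : η ∈ LinearMap.range C) : C (pinv C η) = η := by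
  have hc := (Submodule.isCompl_orthogonal (K := LinearMap.ker C)).symm
  have key : ∀ y : LinearMap.range C, C ((C.kerComplementEquivRange hc).symm y : Vec p) = y := by
    intro y
    conv_rhs => rw [← (C.kerComplementEquivRange hc).apply_symm_apply y]
    rfl
  have h := key ((LinearMap.range C).orthogonalProjectionOnto η)
  rw [← Submodule.starProjection_apply, Submodule.starProjection_eq_self_iff.2 hη] at h
  exact h

lemma eq_of_map_eq (hC : C.IsSymmetric) {x y : Vec p} (hx : x ∈ LinearMap.range C)
    (hy : y ∈ LinearMap.range C) (h : C x = C y) : x = y := by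
  have h1 : x - y ∈ (LinearMap.range C)ᗮ := by
    rw [hC.orthogonal_range, LinearMap.mem_ker, map_sub, h, sub_self]
  have h2 : x - y ∈ LinearMap.range C := Submodule.sub_mem _ hx hy
  exact sub_eq_zero.1 (inner_self_eq_zero.1 (Submodule.inner_right_of_mem_orthogonal h2 h1))

lemma inner_pinv_comm (hC : C.IsSymmetric) {η ζ : Vec p} (hη : η ∈ LinearMap.range C)
    (hζ : ζ ∈ LinearMap.range C) : inner ℝ (pinv C η) ζ = inner ℝ (pinv C ζ) η := by
  conv_lhs => rw [← map_pinv hζ, ← hC, map_pinv hη, real_inner_comm]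

/-- The quadratic form of the pseudo-inverse of a positive operator is coercive on the range. -/
lemma exists_coercive_pinv (hC : C.IsPositive) :
    ∃ c > 0, ∀ η ∈ LinearMap.range C, c * ‖η‖ ^ 2 ≤ inner ℝ (pinv C η) η := by
  obtain ⟨c, hc, h⟩ := exists_coercive hC
  set M := ‖LinearMap.toContinuousLinearMap C‖ + 1
  have hM : 0 < M := by positivity
  refine ⟨c / M ^ 2, by positivity, fun η hη => ?_⟩
  have h1 := h _ (pinv_mem_range hC.isSymmetric η)
  rw [map_pinv hη, real_inner_comm] at h1
  refine le_trans ?_ h1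
  have h2 : ‖η‖ ≤ M * ‖pinv C η‖ := by
    conv_lhs => rw [← map_pinv hη]
    refine ((LinearMap.toContinuousLinearMap C).le_opNorm _).trans ?_
    gcongr
    simp [M]
  calc c / M ^ 2 * ‖η‖ ^ 2 ≤ c / M ^ 2 * (M * ‖pinv C η‖) ^ 2 := by gcongr
    _ = c * ‖pinv C η‖ ^ 2 := by field_simp

/-- The quadratic form of the pseudo-inverse has exactly one minimizer over a nonempty closed convex
set, restricted to the range. -/
lemma exists_unique_isMinOn_pinv (hC : C.IsPositive) {D : Set (Vec p)} (hD : IsClosed D)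
    (hconv : Convex ℝ D) (hne : (D ∩ (LinearMap.range C : Set (Vec p))).Nonempty) :
    ∃ η₀ ∈ D ∩ (LinearMap.range C : Set (Vec p)),
      IsMinOn (fun ζ : Vec p => (inner ℝ (pinv C ζ) ζ : ℝ))
        (D ∩ (LinearMap.range C : Set (Vec p))) η₀ ∧
      ∀ η ∈ D ∩ (LinearMap.range C : Set (Vec p)),
        IsMinOn (fun ζ : Vec p => (inner ℝ (pinv C ζ) ζ : ℝ))
          (D ∩ (LinearMap.range C : Set (Vec p))) η → η = η₀ := by
  obtain ⟨c, hc, hcoer⟩ := exists_coercive_pinv hC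
  have hcont : Continuous fun v : Vec p => (inner ℝ (pinv C v) v : ℝ) :=
    (LinearMap.continuous_of_finiteDimensional (pinv C)).inner continuous_id
  obtain ⟨ζ, hζ⟩ := hne
  have hclosed : IsClosed (D ∩ (LinearMap.range C : Set (Vec p))) :=
    hD.inter (Submodule.closed_of_finiteDimensional _)
  obtain ⟨η₀, h₀, hmin⟩ := hcont.continuousOn.exists_isMinOn' hclosed hζ (by
    have h1 : Tendsto (fun v : Vec p => c * ‖v‖ ^ 2) (cocompact (Vec p)) atTop :=
      ((tendsto_pow_atTop two_ne_zero).comp (tendsto_norm_cocompact_atTop)).const_mul_atTop hc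
    refine eventually_inf_principal.2 ?_
    filter_upwards [h1.eventually_ge_atTop (inner ℝ (pinv C ζ) ζ)] with v hv hvD
    exact hv.trans (hcoer v hvD.2))
  refine ⟨η₀, h₀, hmin, fun η hη hmin' => ?_⟩
  -- parallelogram identity at the midpoint of two minimizers
  have hmid : (1 / 2 : ℝ) • η + (1 / 2 : ℝ) • η₀ ∈ D ∩ (LinearMap.range C : Set (Vec p)) :=
    (hconv.inter (LinearMap.range C).convex) hη h₀ (by norm_num) (by norm_num) (by norm_num)
  have h1 := hmin hmid
  have h2 := hmin' h₀
  have h3 := hmin hη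
  have h4 := hcoer _ (Submodule.sub_mem _ hη.2 h₀.2)
  have h5 := inner_pinv_comm hC.isSymmetric hη.2 h₀.2
  simp only [Set.mem_ofPred_eq, map_add, map_smul, map_sub, inner_add_left, inner_add_right,
    inner_sub_left, inner_sub_right, inner_smul_left, inner_smul_right, conj_trivial] at h1 h2 h3 h4
  have h6 : c * ‖η - η₀‖ ^ 2 ≤ 0 := by linarith
  have h7 : ‖η - η₀‖ ^ 2 ≤ 0 := by
    by_contra! h
    nlinarith
  exact sub_eq_zero.1 (norm_eq_zero.1 (pow_eq_zero_iff two_ne_zero |>.1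
    (le_antisymm h7 (sq_nonneg _))))

end Linear

end ConvexAnalysis

/-! ### Stability of regularized quadratic problems -/

section Stability

variable {p : ℕ} {R : Vec p → EReal}

/-- A quadratic objective regularized by `R`: `lam * R w + ⟨A w, w⟩ / 2 - ⟨u, w⟩ + c`. -/
noncomputable def quadObj (R : Vec p → EReal) (lam : ℝ) (A : Vec p →ₗ[ℝ] Vec p) (u : Vec p) (c : ℝ)
    (w : Vec p) : EReal :=
  (lam : EReal) * R w + ((inner ℝ (A w) w / 2 - inner ℝ u w + c : ℝ) : EReal)

section QuadObj

variable {C A : Vec p →ₗ[ℝ] Vec p} {u w w₀ : Vec p} {lam c r r₀ : ℝ}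

lemma quadObj_of_eq_coe (hr : R w = r) : quadObj R lam A u c w =
    ((lam * r + (inner ℝ (A w) w / 2 - inner ℝ u w + c) : ℝ) : EReal) := by
  rw [quadObj, hr]; push_cast; rfl

lemma quadObj_le_of_le (hlam : 0 ≤ lam) (hr : R w ≤ r) : quadObj R lam A u c w ≤
    ((lam * r + (inner ℝ (A w) w / 2 - inner ℝ u w + c) : ℝ) : EReal) := by
  rw [quadObj, EReal.coe_add (lam * r), EReal.coe_mul]
  exact add_le_add_left (mul_le_mul_of_nonneg_left hr (EReal.coe_nonneg.2 hlam)) _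

lemma exists_coe_of_quadObj_le (hbot : ∀ w, R w ≠ ⊥) (hlam : 0 < lam) (hr : R w₀ = r₀)
    (h : quadObj R lam A u c w ≤ quadObj R lam A u c w₀) : ∃ r : ℝ, R w = r := by
  refine ⟨(R w).toReal, (EReal.coe_toReal (fun htop => ?_) (hbot w)).symm⟩
  rw [quadObj_of_eq_coe hr, quadObj, htop, EReal.coe_mul_top_of_pos hlam,
    EReal.top_add_coe, top_le_iff] at h
  exact EReal.coe_ne_top _ h

lemma lowerSemicontinuous_quadObj (hlsc : LowerSemicontinuous R)
    (hlam : 0 < lam) : LowerSemicontinuous (quadObj R lam A u c) := by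
  have h1 : LowerSemicontinuous fun w => (lam : EReal) * R w := by
    refine Continuous.comp_lowerSemicontinuous (g := fun x : EReal => (lam : EReal) * x) ?_ hlsc ?_
    · have h0 : (lam : EReal) ≠ 0 := by exact_mod_cast hlam.ne'
      exact continuous_iff_continuousAt.2 fun x => (EReal.continuousAt_mul (p := (lam, x))
        (Or.inl h0) (Or.inl h0) (Or.inl (EReal.coe_ne_bot _)) (Or.inl (EReal.coe_ne_top _))).comp
        (by fun_prop : ContinuousAt (fun x : EReal => ((lam : EReal), x)) x)
    · intro x y h
      exact mul_le_mul_of_nonneg_left h (EReal.coe_nonneg.2 hlam.le)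
  have h2 : Continuous fun w : Vec p =>
      ((inner ℝ (A w) w / 2 - inner ℝ u w + c : ℝ) : EReal) := by
    have := LinearMap.continuous_of_finiteDimensional A
    exact continuous_coe_real_ereal.comp (by fun_prop)
  refine h1.add' h2.lowerSemicontinuous fun w => ?_
  exact EReal.continuousAt_add (Or.inr (EReal.coe_ne_bot _)) (Or.inr (EReal.coe_ne_top _))

lemma nonneg_of_forall_nonneg_add_sq {a q : ℝ}
    (h : ∀ t, 0 < t → t ≤ 1 → 0 ≤ t * a + t ^ 2 * q) : 0 ≤ a := by
  have ht : Tendsto (fun t : ℝ => a + t * q) (𝓝[>] 0) (𝓝 a) := by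
    have : Tendsto (fun t : ℝ => a + t * q) (𝓝 0) (𝓝 (a + 0 * q)) :=
      (Continuous.tendsto (by fun_prop) 0)
    rw [zero_mul, add_zero] at this
    exact this.mono_left nhdsWithin_le_nhds
  refine ge_of_tendsto ht ?_
  filter_upwards [Ioc_mem_nhdsGT one_pos] with t ⟨h0, h1⟩
  have := h t h0 h1
  have e : t * a + t ^ 2 * q = t * (a + t * q) := by ring
  rw [e] at this
  exact nonneg_of_mul_nonneg_right this h0

/-- Fermat's rule: the first-order optimality condition for the regularized objective. -/
lemma smul_sub_mem_subdiff (hbot : ∀ w, R w ≠ ⊥) (hconv : IsConvex R) (hA : A.IsSymmetric)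
    (hlam : 0 < lam) (hr : R w = r) (hmin : IsMinOn (quadObj R lam A u c) Set.univ w) :
    (1 / lam) • (u - A w) ∈ subdiff R w := by
  rw [mem_subdiff_iff hr]
  intro v
  induction hv : R v with
  | bot => exact absurd hv (hbot v)
  | top => exact le_top
  | coe b =>
    rw [EReal.coe_le_coe_iff]
    have key : 0 ≤ lam * (b - r) + (inner ℝ (A w) (v - w) - inner ℝ u (v - w)) := by
      refine nonneg_of_forall_nonneg_add_sq (q := inner ℝ (A (v - w)) (v - w) / 2)
        fun t h0 h1 => ?_
      have h2 := (hmin (Set.mem_univ (w + t • (v - w)))).trans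
        (quadObj_le_of_le hlam.le (hconv.le_of_le hr.le hv.le h0.le h1))
      rw [quadObj_of_eq_coe hr, EReal.coe_le_coe_iff, inner_map_add_smul hA, inner_add_right,
        inner_smul_right] at h2
      linarith
    rw [inner_smul_left, conj_trivial, inner_sub_left]
    have : 1 / lam * (inner ℝ u (v - w) - inner ℝ (A w) (v - w)) ≤ b - r := by
      rw [one_div_mul_eq_div, div_le_iff₀ hlam]
      linarith
    linarith

/-- If `w` is not worse than `w₀` for the regularized objective, then a source condition
`η ∈ ∂R(w₀) ∩ Im C` bounds, at the order of `lam`, the component of `w - w₀` in `Im C` and the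
excess of `R` at `w`. -/
lemma norm_starProjection_le_and_le (hbot : ∀ w, R w ≠ ⊥) (hC : C.IsSymmetric)
    (hA : A.IsSymmetric) (hker : LinearMap.ker C ≤ LinearMap.ker A) {κ : ℝ} (hκ : 0 < κ)
    (hcoer : ∀ v ∈ LinearMap.range C, κ * ‖v‖ ^ 2 ≤ inner ℝ (A v) v)
    (hlam : 0 < lam) (hr : R w₀ = r₀) {η : Vec p} (hη : η ∈ subdiff R w₀)
    (hηC : η ∈ LinearMap.range C) (hεC : u - A w₀ ∈ LinearMap.range C)
    (hε : ‖(1 / lam) • (u - A w₀)‖ ≤ 1)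
    (h : quadObj R lam A u c w ≤ quadObj R lam A u c w₀) :
    ‖(LinearMap.range C).starProjection (w - w₀)‖ ≤ lam * (2 / κ * (1 + ‖η‖)) ∧
      R w ≤ ((r₀ + lam * (2 / κ * (1 + ‖η‖)) : ℝ) : EReal) := by
  obtain ⟨r, hrw⟩ := exists_coe_of_quadObj_le hbot hlam hr h
  set V := LinearMap.range C
  set v := w - w₀ with hv
  set q := V.starProjection v with hq
  set ε := u - A w₀ with hεdef
  have hqV : q ∈ V := Submodule.starProjection_apply_mem _ _
  have hAq : A q = A v := map_eq_map_starProjection_range hC hker v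
  have hw : w = w₀ + (1 : ℝ) • v := by rw [hv]; module
  have h1 : lam * (r - r₀) + inner ℝ (A q) q / 2 - inner ℝ ε q ≤ 0 := by
    have e1 : (inner ℝ (A q) q : ℝ) = inner ℝ (A v) v := by
      rw [hAq, hA v q, hAq, ← hA v v]
    rw [quadObj_of_eq_coe hrw, quadObj_of_eq_coe hr, EReal.coe_le_coe_iff] at h
    rw [e1, inner_starProjection_right hεC]
    rw [hw, inner_map_add_smul hA, inner_add_right, inner_smul_right] at h
    rw [hεdef, inner_sub_left]
    linarith
  have h2 : r₀ + inner ℝ η q ≤ r := by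
    have := (mem_subdiff_iff hr).1 hη w
    rw [hrw, EReal.coe_le_coe_iff] at this
    rwa [hq, inner_starProjection_right hηC]
  have h3 := hcoer q hqV
  have hε' : ‖ε‖ ≤ lam := by
    rwa [norm_smul, Real.norm_of_nonneg (by positivity), one_div_mul_eq_div, div_le_one hlam] at hε
  have h4 : inner ℝ ε q ≤ lam * ‖q‖ :=
    (real_inner_le_norm _ _).trans (by gcongr)
  have h5 : -(‖η‖ * ‖q‖) ≤ inner ℝ η q := (abs_le.1 (abs_real_inner_le_norm η q)).1
  have hq0 : 0 ≤ ‖q‖ := norm_nonneg _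
  have h6 : ‖q‖ ≤ lam * (2 / κ * (1 + ‖η‖)) := by
    rcases hq0.eq_or_lt with h0 | h0
    · rw [← h0]; positivity
    have h7 : κ / 2 * ‖q‖ * ‖q‖ ≤ lam * (1 + ‖η‖) * ‖q‖ := by
      have := mul_le_mul_of_nonneg_left (show -(‖η‖ * ‖q‖) ≤ r - r₀ by linarith) hlam.le
      nlinarith
    have h8 := le_of_mul_le_mul_right h7 h0
    calc ‖q‖ = 2 / κ * (κ / 2 * ‖q‖) := by field_simp
      _ ≤ 2 / κ * (lam * (1 + ‖η‖)) := by gcongr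
      _ = _ := by ring
  refine ⟨h6, ?_⟩
  rw [hrw, EReal.coe_le_coe_iff]
  have h9 : lam * (r - r₀) ≤ lam * ‖q‖ := by
    nlinarith [mul_nonneg hκ.le (sq_nonneg ‖q‖)]
  have := le_of_mul_le_mul_left h9 hlam
  linarith

end QuadObj

lemma range_le_range_of_ker_le_ker {C A : Vec p →ₗ[ℝ] Vec p} (hC : C.IsSymmetric)
    (hA : A.IsSymmetric) (h : LinearMap.ker C ≤ LinearMap.ker A) :
    LinearMap.range A ≤ LinearMap.range C := by
  have h1 := Submodule.orthogonal_le (h.trans_eq hA.orthogonal_range.symm)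
  rwa [← hC.orthogonal_range, Submodule.orthogonal_orthogonal,
    Submodule.orthogonal_orthogonal] at h1

/-- Deterministic stability: if the operators `A n` and vectors `u n` of the regularized quadratic
problems approach `C` and `C w₀` faster than `lam n`, then the problems have solutions for large
`n`, and these converge together with their dual vectors. The growth lemma and the source condition
give the primal limit. For the dual one, `z = -q / lam`, with `q` the component of `w - w₀` in
`Im C`, is bounded and satisfies `A z ≈ η`; monotonicity of the subdifferential makes each cluster
point of the dual vectors satisfy the variational inequality that characterizes `η₀`. -/
theorem exists_isMinOn_and_tendsto {C : Vec p →ₗ[ℝ] Vec p} {w₀ η₀ : Vec p} {r₀ : ℝ}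
    (hbot : ∀ w, R w ≠ ⊥) (hlsc : LowerSemicontinuous R) (hconv : IsConvex R) (hr : R w₀ = r₀)
    (hC : C.IsPositive) (huniq : ∀ v ∈ LinearMap.ker C, R (w₀ + v) ≤ r₀ → v = 0)
    (hη₀ : η₀ ∈ subdiff R w₀ ∩ (LinearMap.range C : Set (Vec p)))
    (hη₀_unique : ∀ η ∈ subdiff R w₀ ∩ (LinearMap.range C : Set (Vec p)),
      IsMinOn (fun ζ : Vec p => (inner ℝ (pinv C ζ) ζ : ℝ))
        (subdiff R w₀ ∩ (LinearMap.range C : Set (Vec p))) η → η = η₀)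
    {lam : ℕ → ℝ} (hlam_pos : ∀ n, 0 < lam n) (hlam : Tendsto lam atTop (𝓝 0))
    {A : ℕ → Vec p →ₗ[ℝ] Vec p} (hA : ∀ n, (A n).IsPositive)
    (hker : ∀ n, LinearMap.ker C ≤ LinearMap.ker (A n)) {e : ℕ → ℝ} (he : Tendsto e atTop (𝓝 0))
    (hAe : ∀ n v, ‖A n v - C v‖ ≤ e n * ‖v‖)
    {u : ℕ → Vec p} (hu : ∀ n, u n ∈ LinearMap.range C)
    (hε : Tendsto (fun n => (1 / lam n) • (u n - A n w₀)) atTop (𝓝 0)) (c : ℕ → ℝ) :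
    (∀ᶠ n in atTop, ∃ w, IsMinOn (quadObj R (lam n) (A n) (u n) (c n)) Set.univ w) ∧
      ∀ w : ℕ → Vec p,
        (∀ᶠ n in atTop, IsMinOn (quadObj R (lam n) (A n) (u n) (c n)) Set.univ (w n)) →
        Tendsto w atTop (𝓝 w₀) ∧
          Tendsto (fun n => (1 / lam n) • (u n - A n (w n))) atTop (𝓝 η₀) := by
  have hCs := hC.isSymmetric
  set V := LinearMap.range C with hVdef
  have hAV : ∀ n v, A n v ∈ V := fun n v =>
    range_le_range_of_ker_le_ker hCs (hA n).isSymmetric (hker n) ⟨v, rfl⟩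
  have hεV : ∀ n, u n - A n w₀ ∈ V := fun n => V.sub_mem (hu n) (hAV n w₀)
  obtain ⟨κ, hκ, hcoer⟩ := exists_coercive hC
  -- coercivity of `C` on its range passes to the nearby operators `A n`, with half the constant
  have hcoerA : ∀ᶠ n in atTop, ∀ v ∈ V, κ / 2 * ‖v‖ ^ 2 ≤ inner ℝ (A n v) v := by
    filter_upwards [he.eventually_le_const (half_pos hκ)] with n hn v hv
    have h1 := hcoer v hv
    have h2 : |(inner ℝ (A n v - C v) v : ℝ)| ≤ κ / 2 * ‖v‖ * ‖v‖ :=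
      (abs_real_inner_le_norm _ _).trans (by gcongr; exact (hAe n v).trans (by gcongr))
    have h3 := (abs_le.1 h2).1
    rw [inner_sub_left] at h3
    nlinarith
  have hε1 : ∀ᶠ n in atTop, ‖(1 / lam n) • (u n - A n w₀)‖ ≤ 1 := by
    have := hε.norm
    rw [norm_zero] at this
    exact this.eventually_le_const one_pos
  set β := 2 / (κ / 2) * (1 + ‖η₀‖) with hβ
  have hβ0 : 0 ≤ β := by positivity
  have hbound : ∀ᶠ n in atTop, ∀ w, quadObj R (lam n) (A n) (u n) (c n) w ≤
      quadObj R (lam n) (A n) (u n) (c n) w₀ →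
      ‖V.starProjection (w - w₀)‖ ≤ lam n * β ∧ R w ≤ ((r₀ + lam n * β : ℝ) : EReal) := by
    filter_upwards [hcoerA, hε1] with n h1 h2 w hw
    exact norm_starProjection_le_and_le hbot hCs (hA n).isSymmetric (hker n) (half_pos hκ) h1
      (hlam_pos n) hr hη₀.1 hη₀.2 (hεV n) h2 hw
  -- for large `n`, all points not worse than `w₀` are close to `w₀`
  have hloc : ∀ δ > 0, ∀ᶠ n in atTop, ∀ w, quadObj R (lam n) (A n) (u n) (c n) w ≤
      quadObj R (lam n) (A n) (u n) (c n) w₀ → ‖w - w₀‖ < δ := by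
    intro δ hδ
    obtain ⟨α, hα, hgrow⟩ := exists_growth hlsc hconv hr V
      (by rw [hVdef, hCs.orthogonal_range]; exact huniq) hδ
    have hlim : Tendsto (fun n => lam n * β) atTop (𝓝 0) := by simpa using hlam.mul_const β
    filter_upwards [hbound, hlim.eventually_lt_const hα] with n h1 h2 w hw
    obtain ⟨h3, h4⟩ := h1 w hw
    by_contra! hcon
    have h5 := hgrow (w - w₀) (lam n * β) hcon h3 (by rwa [add_sub_cancel])
    nlinarith
  constructor
  · filter_upwards [hloc 1 one_pos] with n hn
    obtain ⟨w, -, hw⟩ := LowerSemicontinuousOn.exists_isMinOn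
      (s := Metric.closedBall w₀ 1) ⟨w₀, by simp⟩ (isCompact_closedBall _ _)
      ((lowerSemicontinuous_quadObj (A := A n) (u := u n) (c := c n) hlsc
        (hlam_pos n)).lowerSemicontinuousOn _)
    refine ⟨w, fun w' _ => ?_⟩
    by_cases h : quadObj R (lam n) (A n) (u n) (c n) w' ≤ quadObj R (lam n) (A n) (u n) (c n) w₀
    · exact hw (mem_closedBall_iff_norm.2 (hn w' h).le)
    · exact (hw (by simp : w₀ ∈ Metric.closedBall w₀ 1)).trans (not_le.1 h).le
  intro w hw
  have hw' : ∀ᶠ n in atTop, quadObj R (lam n) (A n) (u n) (c n) (w n) ≤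
      quadObj R (lam n) (A n) (u n) (c n) w₀ := hw.mono fun n h => h (Set.mem_univ _)
  have hwlim : Tendsto w atTop (𝓝 w₀) := by
    refine Metric.tendsto_nhds.2 fun δ hδ => ?_
    filter_upwards [hloc δ hδ, hw'] with n h1 h2
    rw [dist_eq_norm]
    exact h1 _ h2
  refine ⟨hwlim, ?_⟩
  set η : ℕ → Vec p := fun n => (1 / lam n) • (u n - A n (w n)) with hηdef
  set z : ℕ → Vec p := fun n => -((1 / lam n) • V.starProjection (w n - w₀)) with hzdef
  have hzV : ∀ n, z n ∈ V := fun n =>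
    V.neg_mem (V.smul_mem _ (Submodule.starProjection_apply_mem _ _))
  have hηV : ∀ n, η n ∈ V := fun n => V.smul_mem _ (V.sub_mem (hu n) (hAV n _))
  have hηz : ∀ n, η n = (1 / lam n) • (u n - A n w₀) + A n (z n) := fun n => by
    simp only [hηdef, hzdef]
    rw [map_neg, map_smul, map_eq_map_starProjection_range hCs (hker n), map_sub]
    module
  have hzb : ∀ᶠ n in atTop, ‖z n‖ ≤ β := by
    filter_upwards [hbound, hw'] with n h1 h2
    have h3 := (h1 _ h2).1
    have hl := hlam_pos n
    rw [hzdef]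
    simp only [norm_neg, norm_smul]
    rw [Real.norm_of_nonneg (by positivity), one_div_mul_eq_div, div_le_iff₀ hl]
    linarith
  have hreal : ∀ᶠ n in atTop, ∃ r : ℝ, R (w n) = r := hw'.mono fun n h =>
    exists_coe_of_quadObj_le hbot (hlam_pos n) hr h
  have hsub : ∀ᶠ n in atTop, η n ∈ subdiff R (w n) := by
    filter_upwards [hw, hreal] with n h1 ⟨r, h2⟩
    exact smul_sub_mem_subdiff hbot hconv (hA n).isSymmetric (hlam_pos n) h2 h1
  -- monotonicity of the subdifferential
  have hmono : ∀ᶠ n in atTop, ∀ ζ ∈ subdiff R w₀ ∩ (V : Set (Vec p)),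
      inner ℝ (η n - ζ) (z n) ≤ 0 := by
    filter_upwards [hsub, hreal] with n h1 ⟨r, h2⟩ ζ hζ
    have h3 := (mem_subdiff_iff h2).1 h1 w₀
    have h4 := (mem_subdiff_iff hr).1 hζ.1 (w n)
    rw [hr, EReal.coe_le_coe_iff] at h3
    rw [h2, EReal.coe_le_coe_iff] at h4
    have h5 : 0 ≤ inner ℝ (η n - ζ) (w n - w₀) := by
      rw [← neg_sub (w n) w₀, inner_neg_right] at h3
      rw [inner_sub_left]
      linarith
    have hl := hlam_pos n
    simp only [hzdef, inner_neg_right, inner_smul_right]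
    rw [inner_starProjection_right (V.sub_mem (hηV n) hζ.2)]
    have : 0 ≤ 1 / lam n * inner ℝ (η n - ζ) (w n - w₀) := by positivity
    linarith
  refine tendsto_of_subseq_tendsto fun ns hns => ?_
  obtain ⟨zs, -, φ, hφ, hzlim⟩ := tendsto_subseq_of_frequently_bounded
    (x := fun k => z (ns k)) (Metric.isBounded_closedBall (x := (0 : Vec p)) (r := β))
    ((hns.eventually hzb).mono fun k h => by simpa using h).frequently
  refine ⟨φ, ?_⟩
  have hsn : Tendsto (fun k => ns (φ k)) atTop atTop := hns.comp hφ.tendsto_atTop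
  have hzsV : zs ∈ V := (Submodule.closed_of_finiteDimensional V).mem_of_tendsto hzlim
    (.of_forall fun k => hzV _)
  have hηlim : Tendsto (fun k => η (ns (φ k))) atTop (𝓝 (C zs)) := by
    have h1 : Tendsto (fun k => A (ns (φ k)) (z (ns (φ k))) - C (z (ns (φ k)))) atTop (𝓝 0) := by
      have h2 : Tendsto (fun k => |e (ns (φ k))| * β) atTop (𝓝 0) := by
        simpa using (he.comp hsn).abs.mul_const β
      refine squeeze_zero_norm' ?_ h2
      filter_upwards [hsn.eventually hzb] with k hk
      exact (hAe _ _).trans (mul_le_mul (le_abs_self _) hk (norm_nonneg _) (abs_nonneg _))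
    have h2 : Tendsto (fun k => C (z (ns (φ k)))) atTop (𝓝 (C zs)) :=
      ((LinearMap.continuous_of_finiteDimensional C).tendsto zs).comp hzlim
    have h3 := ((hε.comp hsn).add h1).add h2
    rw [zero_add, zero_add] at h3
    refine h3.congr fun k => ?_
    rw [hηz]
    simp only [Function.comp]
    abel
  -- the graph of the subdifferential of a lower semicontinuous function is closed
  have hfeas : C zs ∈ subdiff R w₀ ∩ (V : Set (Vec p)) := by
    refine ⟨(mem_subdiff_iff hr).2 fun v => ?_, ⟨zs, rfl⟩⟩
    induction hv : R v with
    | bot => exact absurd hv (hbot v)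
    | top => exact le_top
    | coe b =>
      rw [EReal.coe_le_coe_iff]
      have hlim : Tendsto (fun k => b - inner ℝ (η (ns (φ k))) (v - w (ns (φ k)))) atTop
          (𝓝 (b - inner ℝ (C zs) (v - w₀))) :=
        tendsto_const_nhds.sub (hηlim.inner (tendsto_const_nhds.sub (hwlim.comp hsn)))
      have h := le_of_tendsto_of_frequently_le hlsc (hwlim.comp hsn) hlim (by
        refine Eventually.frequently ?_
        filter_upwards [hsn.eventually hsub, hsn.eventually hreal] with k h1 ⟨r, h2⟩
        have h3 := (mem_subdiff_iff h2).1 h1 v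
        rw [hv, EReal.coe_le_coe_iff] at h3
        simp only [Function.comp, h2, EReal.coe_le_coe_iff]
        linarith)
      rw [hr, EReal.coe_le_coe_iff] at h
      linarith
  have hpz : pinv C (C zs) = zs :=
    eq_of_map_eq hCs (pinv_mem_range hCs _) hzsV (map_pinv ⟨zs, rfl⟩)
  -- the limit of the monotonicity inequality is the variational inequality for `η₀`
  have hmin : C zs = η₀ := by
    refine hη₀_unique _ hfeas fun ζ hζ => ?_
    have h1 : inner ℝ (C zs - ζ) zs ≤ 0 := by
      refine le_of_tendsto ((hηlim.sub_const ζ).inner hzlim) ?_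
      filter_upwards [hsn.eventually hmono] with k hk
      exact hk ζ hζ
    obtain ⟨κ', hκ', hcoer'⟩ := exists_coercive_pinv hC
    have h2 := hcoer' _ (V.sub_mem hζ.2 hfeas.2)
    have h3 := inner_pinv_comm hCs hζ.2 hfeas.2
    have h4 : 0 ≤ κ' * ‖ζ - C zs‖ ^ 2 := by positivity
    simp only [Set.mem_ofPred_eq, map_sub, inner_sub_left, inner_sub_right, hpz] at h1 h2 h3 ⊢
    rw [real_inner_comm zs (C zs), real_inner_comm zs ζ] at h1
    linarith
  rw [← hmin]
  exact hηlim

end Stability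

/-! ### Population and empirical quadratic risks -/

section Risk

variable {p : ℕ}

lemma inner_toEuclideanLin (M : Matrix (Fin p) (Fin p) ℝ) (v w : Vec p) :
    inner ℝ (Matrix.toEuclideanLin M v) w = ∑ i, ∑ j, M i j * (v j * w i) := by
  simp only [PiLp.inner_apply, Matrix.ofLp_toLpLin, Matrix.toLin'_apply, Matrix.mulVec,
    dotProduct, RCLike.inner_apply, conj_trivial, Finset.mul_sum]
  exact Finset.sum_congr rfl fun i _ => Finset.sum_congr rfl fun j _ => by ring

lemma inner_mul_inner_eq_sum (x v w : Vec p) :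
    (inner ℝ x v : ℝ) * inner ℝ x w = ∑ i, ∑ j, x i * x j * (v j * w i) := by
  simp only [PiLp.inner_apply, RCLike.inner_apply, conj_trivial]
  rw [mul_comm, Finset.sum_mul_sum]
  exact Finset.sum_congr rfl fun i _ => Finset.sum_congr rfl fun j _ => by ring

section Population

variable {ρ : Measure (Vec p × ℝ)}

/-- The fourth-moment conditions in the form used here: they apply to all products `g` of two
coordinates of `(x, y)`, which the law of the iterated logarithm needs in `L²`. -/
lemma memLp_two_of_sq_le (hx4 : Integrable (fun z : Vec p × ℝ => ‖z.1‖ ^ 4) ρ)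
    (hy4 : Integrable (fun z : Vec p × ℝ => |z.2| ^ 4) ρ) {g : Vec p × ℝ → ℝ} (hg : Measurable g)
    (h : ∀ z, g z ^ 2 ≤ ‖z.1‖ ^ 4 + |z.2| ^ 4) : MemLp g 2 ρ := by
  rw [memLp_two_iff_integrable_sq hg.aestronglyMeasurable]
  refine (hx4.add hy4).mono (hg.pow_const 2).aestronglyMeasurable (.of_forall fun z => ?_)
  rw [Real.norm_of_nonneg (sq_nonneg _)]
  exact (h z).trans (le_abs_self _)

lemma memLp_two_coord_mul_coord (hx4 : Integrable (fun z : Vec p × ℝ => ‖z.1‖ ^ 4) ρ)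
    (hy4 : Integrable (fun z : Vec p × ℝ => |z.2| ^ 4) ρ) (i j : Fin p) :
    MemLp (fun z : Vec p × ℝ => z.1 i * z.1 j) 2 ρ := by
  refine memLp_two_of_sq_le hx4 hy4 (by fun_prop) fun z => ?_
  have h1 : z.1 i ^ 2 ≤ ‖z.1‖ ^ 2 := sq_le_sq.2 (by simpa using PiLp.norm_apply_le z.1 i)
  have h2 : z.1 j ^ 2 ≤ ‖z.1‖ ^ 2 := sq_le_sq.2 (by simpa using PiLp.norm_apply_le z.1 j)
  have h3 := mul_le_mul h1 h2 (sq_nonneg _) (sq_nonneg _)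
  have h4 : 0 ≤ |z.2| ^ 4 := by positivity
  nlinarith

lemma memLp_two_snd_mul_coord (hx4 : Integrable (fun z : Vec p × ℝ => ‖z.1‖ ^ 4) ρ)
    (hy4 : Integrable (fun z : Vec p × ℝ => |z.2| ^ 4) ρ) (j : Fin p) :
    MemLp (fun z : Vec p × ℝ => z.2 * z.1 j) 2 ρ := by
  refine memLp_two_of_sq_le hx4 hy4 (by fun_prop) fun z => ?_
  have h2 : z.1 j ^ 2 ≤ ‖z.1‖ ^ 2 := sq_le_sq.2 (by simpa using PiLp.norm_apply_le z.1 j)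
  have h3 := mul_le_mul_of_nonneg_left h2 (sq_nonneg |z.2|)
  have h4 := sq_abs z.2
  nlinarith [sq_nonneg (|z.2| ^ 2 - ‖z.1‖ ^ 2), sq_nonneg (|z.2| ^ 2 + ‖z.1‖ ^ 2)]

lemma memLp_two_snd_sq (hx4 : Integrable (fun z : Vec p × ℝ => ‖z.1‖ ^ 4) ρ)
    (hy4 : Integrable (fun z : Vec p × ℝ => |z.2| ^ 4) ρ) :
    MemLp (fun z : Vec p × ℝ => z.2 ^ 2) 2 ρ := by
  refine memLp_two_of_sq_le hx4 hy4 (by fun_prop) fun z => ?_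
  have h4 := sq_abs z.2
  have : 0 ≤ ‖z.1‖ ^ 4 := by positivity
  nlinarith

/-- The vector `E_ρ[y x]`. -/
noncomputable def crossCov (ρ : Measure (Vec p × ℝ)) : Vec p :=
  WithLp.toLp 2 fun j => ∫ z, z.2 * z.1 j ∂ρ

variable [IsProbabilityMeasure ρ]

lemma integrable_inner_mul_inner (hx4 : Integrable (fun z : Vec p × ℝ => ‖z.1‖ ^ 4) ρ)
    (hy4 : Integrable (fun z : Vec p × ℝ => |z.2| ^ 4) ρ) (v w : Vec p) :
    Integrable (fun z : Vec p × ℝ => (inner ℝ z.1 v : ℝ) * inner ℝ z.1 w) ρ := by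
  simp_rw [inner_mul_inner_eq_sum]
  exact integrable_finsetSum _ fun i _ => integrable_finsetSum _ fun j _ =>
    ((memLp_two_coord_mul_coord hx4 hy4 i j).integrable one_le_two).mul_const _

lemma inner_cov (hx4 : Integrable (fun z : Vec p × ℝ => ‖z.1‖ ^ 4) ρ)
    (hy4 : Integrable (fun z : Vec p × ℝ => |z.2| ^ 4) ρ) (v w : Vec p) :
    inner ℝ (cov ρ v) w = ∫ z, (inner ℝ z.1 v : ℝ) * inner ℝ z.1 w ∂ρ := by
  have hi : ∀ i j, Integrable (fun z : Vec p × ℝ => z.1 i * z.1 j * (v j * w i)) ρ := fun i j =>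
    ((memLp_two_coord_mul_coord hx4 hy4 i j).integrable one_le_two).mul_const _
  simp_rw [inner_mul_inner_eq_sum]
  rw [cov, inner_toEuclideanLin,
    integral_finsetSum _ fun i _ => integrable_finsetSum _ fun j _ => hi i j]
  refine Finset.sum_congr rfl fun i _ => ?_
  rw [integral_finsetSum _ fun j _ => hi i j]
  refine Finset.sum_congr rfl fun j _ => ?_
  rw [integral_mul_const, Matrix.of_apply]

lemma isPositive_cov (hx4 : Integrable (fun z : Vec p × ℝ => ‖z.1‖ ^ 4) ρ)
    (hy4 : Integrable (fun z : Vec p × ℝ => |z.2| ^ 4) ρ) : (cov ρ).IsPositive := by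
  refine ⟨fun v w => ?_, fun v => ?_⟩
  · rw [inner_cov hx4 hy4, real_inner_comm, inner_cov hx4 hy4]
    simp_rw [mul_comm]
  · rw [inner_cov hx4 hy4]
    exact integral_nonneg fun z => mul_self_nonneg _

lemma integrable_snd_mul_inner (hx4 : Integrable (fun z : Vec p × ℝ => ‖z.1‖ ^ 4) ρ)
    (hy4 : Integrable (fun z : Vec p × ℝ => |z.2| ^ 4) ρ) (w : Vec p) :
    Integrable (fun z : Vec p × ℝ => z.2 * (inner ℝ z.1 w : ℝ)) ρ := by
  simp only [PiLp.inner_apply, RCLike.inner_apply, conj_trivial, Finset.mul_sum]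
  refine integrable_finsetSum _ fun j _ => ?_
  refine (((memLp_two_snd_mul_coord hx4 hy4 j).integrable one_le_two).mul_const (w j)).congr
    (.of_forall fun z => ?_)
  simp only; ring

lemma inner_crossCov (hx4 : Integrable (fun z : Vec p × ℝ => ‖z.1‖ ^ 4) ρ)
    (hy4 : Integrable (fun z : Vec p × ℝ => |z.2| ^ 4) ρ) (w : Vec p) :
    inner ℝ (crossCov ρ) w = ∫ z, z.2 * (inner ℝ z.1 w : ℝ) ∂ρ := by
  simp only [PiLp.inner_apply, RCLike.inner_apply, conj_trivial, Finset.mul_sum]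
  have hi : ∀ j, Integrable (fun z : Vec p × ℝ => z.2 * (w j * z.1 j)) ρ := fun j =>
    (((memLp_two_snd_mul_coord hx4 hy4 j).integrable one_le_two).mul_const (w j)).congr
      (.of_forall fun z => by simp only; ring)
  rw [integral_finsetSum _ fun j _ => hi j]
  refine Finset.sum_congr rfl fun j _ => ?_
  simp only [crossCov]
  rw [← integral_const_mul]
  exact integral_congr_ae (.of_forall fun z => by simp only; ring)

lemma risk_eq (hx4 : Integrable (fun z : Vec p × ℝ => ‖z.1‖ ^ 4) ρ)
    (hy4 : Integrable (fun z : Vec p × ℝ => |z.2| ^ 4) ρ) (w : Vec p) :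
    risk ρ w = inner ℝ (cov ρ w) w - 2 * inner ℝ (crossCov ρ) w + ∫ z, z.2 ^ 2 ∂ρ := by
  have h1 := integrable_inner_mul_inner hx4 hy4 w w
  have h2 := integrable_snd_mul_inner hx4 hy4 w
  have h3 := (memLp_two_snd_sq hx4 hy4).integrable one_le_two
  have h4 : Integrable (fun z : Vec p × ℝ =>
      (inner ℝ z.1 w : ℝ) * inner ℝ z.1 w - 2 * (z.2 * inner ℝ z.1 w)) ρ := h1.sub (h2.const_mul 2)
  rw [inner_cov hx4 hy4, inner_crossCov hx4 hy4, ← integral_const_mul,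
    ← integral_sub h1 (h2.const_mul 2), ← integral_add h4 h3]
  refine integral_congr_ae (.of_forall fun z => ?_)
  simp only
  rw [real_inner_comm]
  ring

lemma risk_add_smul (hx4 : Integrable (fun z : Vec p × ℝ => ‖z.1‖ ^ 4) ρ)
    (hy4 : Integrable (fun z : Vec p × ℝ => |z.2| ^ 4) ρ) (w h : Vec p) (t : ℝ) :
    risk ρ (w + t • h) = risk ρ w + (t * (2 * inner ℝ (cov ρ w - crossCov ρ) h) +
      t ^ 2 * inner ℝ (cov ρ h) h) := by
  rw [risk_eq hx4 hy4, risk_eq hx4 hy4, inner_map_add_smul (isPositive_cov hx4 hy4).isSymmetric,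
    inner_add_right, inner_smul_right, inner_sub_left]
  ring

/-- The normal equation for the minimizers of the expected risk. -/
lemma cov_eq_crossCov (hx4 : Integrable (fun z : Vec p × ℝ => ‖z.1‖ ^ 4) ρ)
    (hy4 : Integrable (fun z : Vec p × ℝ => |z.2| ^ 4) ρ) {w : Vec p}
    (hw : IsMinOn (risk ρ) Set.univ w) : cov ρ w = crossCov ρ := by
  have key : ∀ h, 0 ≤ 2 * (inner ℝ (cov ρ w - crossCov ρ) h : ℝ) := fun h => by
    refine nonneg_of_forall_nonneg_add_sq (q := inner ℝ (cov ρ h) h) fun t _ _ => ?_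
    have h1 := hw (Set.mem_univ (w + t • h))
    simp only [Set.mem_ofPred_eq] at h1
    rw [risk_add_smul hx4 hy4] at h1
    linarith
  have h := key (-(cov ρ w - crossCov ρ))
  rw [inner_neg_right, real_inner_self_eq_norm_sq] at h
  have h2 : ‖cov ρ w - crossCov ρ‖ ^ 2 ≤ 0 := by linarith
  exact sub_eq_zero.1 (norm_eq_zero.1 (pow_eq_zero_iff two_ne_zero |>.1
    (le_antisymm h2 (sq_nonneg _))))

/-- Moving along the kernel of the covariance keeps the risk minimal, so uniqueness of the
population solution says that `w₀` is the strict minimizer of `R` over `w₀ + Ker C`. -/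
lemma eq_zero_of_mem_ker_cov (hx4 : Integrable (fun z : Vec p × ℝ => ‖z.1‖ ^ 4) ρ)
    (hy4 : Integrable (fun z : Vec p × ℝ => |z.2| ^ 4) ρ) {R : Vec p → EReal} {w₀ : Vec p}
    (hw₀ : IsPopulationSol ρ R w₀) (huniq : ∀ w, IsPopulationSol ρ R w → w = w₀) {v : Vec p}
    (hv : v ∈ LinearMap.ker (cov ρ)) (hR : R (w₀ + v) ≤ R w₀) : v = 0 := by
  have hrisk : risk ρ (w₀ + v) = risk ρ w₀ := by
    have h := risk_add_smul hx4 hy4 w₀ v 1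
    rw [cov_eq_crossCov hx4 hy4 hw₀.1, LinearMap.mem_ker.1 hv] at h
    simpa using h
  have h : IsPopulationSol ρ R (w₀ + v) := by
    refine ⟨fun w hw => ?_, fun htop => ?_, fun w hw => hR.trans (hw₀.2.2 hw)⟩
    · simpa [hrisk] using hw₀.1 hw
    · rw [htop, top_le_iff] at hR
      exact hw₀.2.1 hR
  simpa using huniq _ h

/-- Almost surely, `x` lies in the range of the covariance operator. -/
lemma ae_fst_mem_range_cov (hx4 : Integrable (fun z : Vec p × ℝ => ‖z.1‖ ^ 4) ρ)
    (hy4 : Integrable (fun z : Vec p × ℝ => |z.2| ^ 4) ρ) :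
    ∀ᵐ z ∂ρ, z.1 ∈ LinearMap.range (cov ρ) := by
  have hpos := isPositive_cov hx4 hy4
  -- for `v` in the kernel, `⟨x, v⟩` has second moment `⟨C v, v⟩ = 0`
  have h1 : ∀ v ∈ LinearMap.ker (cov ρ), ∀ᵐ z ∂ρ, inner ℝ z.1 v = 0 := by
    intro v hv
    have h := inner_cov hx4 hy4 v v
    rw [LinearMap.mem_ker.1 hv, inner_zero_left, eq_comm,
      integral_eq_zero_iff_of_nonneg (fun z => mul_self_nonneg _)
        (integrable_inner_mul_inner hx4 hy4 v v)] at h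
    filter_upwards [h] with z hz
    exact mul_self_eq_zero.1 hz
  -- it is enough to test against the projections of the basis vectors on the kernel
  set K := LinearMap.ker (cov ρ)
  have h2 : ∀ᵐ z ∂ρ, ∀ j : Fin p,
      inner ℝ z.1 (K.starProjection (EuclideanSpace.single j (1 : ℝ))) = 0 :=
    ae_all_iff.2 fun j => h1 _ (Submodule.starProjection_apply_mem _ _)
  filter_upwards [h2] with z hz
  have h3 : K.starProjection z.1 = 0 := by
    ext j
    have := hz j
    rw [← Submodule.inner_starProjection_left_eq_right, EuclideanSpace.inner_single_right] at this
    simpa using this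
  have h4 := Submodule.sub_starProjection_mem_orthogonal (K := K) z.1
  rw [h3, sub_zero] at h4
  change z.1 ∈ (LinearMap.ker (cov ρ))ᗮ at h4
  rwa [← hpos.isSymmetric.orthogonal_range,
    Submodule.orthogonal_orthogonal] at h4

end Population

section Empirical

variable (s : ℕ → Vec p × ℝ)

lemma inner_empCov (n : ℕ) (v w : Vec p) : inner ℝ (empCov s n v) w =
    (1 / (n : ℝ)) * ∑ i ∈ Finset.range n, (inner ℝ (s i).1 v : ℝ) * inner ℝ (s i).1 w := by
  simp only [inner_mul_inner_eq_sum, empCov, inner_toEuclideanLin, Matrix.smul_apply,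
    Matrix.sum_apply, Matrix.of_apply, smul_eq_mul, Finset.mul_sum, Finset.sum_mul]
  conv_rhs => rw [Finset.sum_comm]
  refine Finset.sum_congr rfl fun j _ => ?_
  conv_rhs => rw [Finset.sum_comm]
  exact Finset.sum_congr rfl fun k _ => Finset.sum_congr rfl fun i _ => by ring

lemma isPositive_empCov (n : ℕ) : (empCov s n).IsPositive := by
  refine ⟨fun v w => ?_, fun v => ?_⟩
  · rw [inner_empCov, real_inner_comm, inner_empCov]
    simp_rw [mul_comm]
  · rw [inner_empCov]
    exact mul_nonneg (by positivity) (Finset.sum_nonneg fun i _ => mul_self_nonneg _)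

lemma inner_empU (n : ℕ) (w : Vec p) : inner ℝ (empU s n) w =
    (1 / (n : ℝ)) * ∑ i ∈ Finset.range n, (s i).2 * inner ℝ (s i).1 w := by
  simp [empU, inner_smul_left, sum_inner]

lemma ermObjective_eq_quadObj (R : Vec p → EReal) (lam : ℝ) (n : ℕ) :
    ermObjective R s lam n = quadObj R lam (empCov s n) (empU s n)
      (1 / (2 * (n : ℝ)) * ∑ i ∈ Finset.range n, (s i).2 ^ 2) := by
  ext w
  rw [ermObjective, quadObj, inner_empCov, inner_empU]
  congr 2
  rw [show 1 / (2 * (n : ℝ)) = 1 / n / 2 by rw [div_div, mul_comm], div_eq_mul_inv (1 / (n : ℝ)) 2]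
  simp only [Finset.mul_sum, Finset.sum_div, ← Finset.sum_sub_distrib, ← Finset.sum_add_distrib]
  exact Finset.sum_congr rfl fun i _ => by ring

variable {s} {C : Vec p →ₗ[ℝ] Vec p}

lemma ker_le_ker_empCov (hC : C.IsSymmetric) (hs : ∀ i, (s i).1 ∈ LinearMap.range C) (n : ℕ) :
    LinearMap.ker C ≤ LinearMap.ker (empCov s n) := by
  intro v hv
  rw [← hC.orthogonal_range] at hv
  rw [LinearMap.mem_ker, ← inner_self_eq_zero (𝕜 := ℝ), inner_empCov]
  simp [fun i => Submodule.inner_right_of_mem_orthogonal (hs i) hv]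

lemma empU_mem_range (hs : ∀ i, (s i).1 ∈ LinearMap.range C) (n : ℕ) :
    empU s n ∈ LinearMap.range C :=
  Submodule.smul_mem _ _ (Submodule.sum_mem _ fun i _ => Submodule.smul_mem _ _ (hs i))

end Empirical

section Limits

variable {Ω : Type*} [MeasurableSpace Ω] {P : Measure Ω}

/-- A rate `lam` that dominates the rate of the law of the iterated logarithm also dominates the
deviations of empirical means of square-integrable functions. -/
lemma ae_tendsto_inv_mul_empirical_mean_sub {𝓧 : Type*} [MeasurableSpace 𝓧] {ρ : Measure 𝓧}
    {Z : ℕ → Ω → 𝓧} (hZ : ∀ i, Measurable (Z i)) (hZρ : ∀ i, P.map (Z i) = ρ)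
    (hindep : iIndepFun Z P) {lam : ℕ → ℝ}
    (hrate : Tendsto (fun n : ℕ => lam n * Real.sqrt (n / Real.log (Real.log n))) atTop atTop)
    {g : 𝓧 → ℝ} (hg : Measurable g) (hg2 : MemLp g 2 ρ) :
    ∀ᵐ ω ∂P, Tendsto (fun n : ℕ => 1 / lam n *
      ((1 / (n : ℝ)) * ∑ i ∈ Finset.range n, g (Z i ω) - ∫ z, g z ∂ρ)) atTop (𝓝 0) := by
  have := hindep.isProbabilityMeasure
  have hρ : IsProbabilityMeasure ρ := by
    rw [← hZρ 0]; exact Measure.isProbabilityMeasure_map (hZ 0).aemeasurable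
  set m := ∫ z, g z ∂ρ
  have hid : ∀ i, IdentDistrib (Z i) (Z 0) P P := fun i =>
    ⟨(hZ i).aemeasurable, (hZ 0).aemeasurable, by rw [hZρ, hZρ]⟩
  have hg2' : MemLp (fun z => g z - m) 2 ρ := hg2.sub (memLp_const m)
  have hlil := ae_sum_isBigO_sqrt_mul_log_log (P := P) (X := fun i ω => g (Z i ω) - m)
    (hindep.comp (fun _ z => g z - m) fun _ => hg.sub_const m)
    (fun i => (hg.comp (hZ i)).sub_const m)
    (fun i => (hid i).comp (hg.sub_const m))
    (by
      rw [← hZρ 0] at hg2'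
      exact hg2'.comp_of_map (hZ 0).aemeasurable)
    (by
      have e := integral_map (μ := P) (hZ 0).aemeasurable (f := fun z => g z - m)
        (hg.sub_const m).aestronglyMeasurable
      rw [← e, hZρ 0, integral_sub (hg2.integrable one_le_two) (integrable_const _)]
      simp [m])
  have ht : Tendsto (fun n : ℕ => Real.log (Real.log n)) atTop atTop :=
    Real.tendsto_log_atTop.comp (Real.tendsto_log_atTop.comp tendsto_natCast_atTop_atTop)
  filter_upwards [hlil] with ω hω
  obtain ⟨K, hK⟩ := hω.bound
  have hlim : Tendsto (fun n : ℕ => K * (lam n * √(n / Real.log (Real.log n)))⁻¹) atTop (𝓝 0) := by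
    simpa using (tendsto_inv_atTop_zero.comp hrate).const_mul K
  refine squeeze_zero_norm' ?_ hlim
  filter_upwards [hK, ht.eventually_gt_atTop 0, eventually_gt_atTop 0,
    hrate.eventually_gt_atTop 0] with n h1 h2 h3 h4
  have hn : (0 : ℝ) < n := by exact_mod_cast h3
  have hsq : 0 < √(n / Real.log (Real.log n)) := Real.sqrt_pos.2 (by positivity)
  have hl : 0 < lam n := pos_of_mul_pos_left h4 hsq.le
  have e1 : (1 / (n : ℝ)) * ∑ i ∈ Finset.range n, g (Z i ω) - m =
      1 / n * ∑ i ∈ Finset.range n, (g (Z i ω) - m) := by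
    rw [Finset.sum_sub_distrib, Finset.sum_const, Finset.card_range, nsmul_eq_mul]
    field_simp
  have e2 : √(n * Real.log (Real.log n)) = n / √(n / Real.log (Real.log n)) := by
    rw [eq_div_iff hsq.ne', ← Real.sqrt_mul (by positivity)]
    rw [show n * Real.log (Real.log n) * (n / Real.log (Real.log n)) = (n : ℝ) ^ 2 by field_simp]
    exact Real.sqrt_sq hn.le
  rw [Real.norm_of_nonneg (Real.sqrt_nonneg _), e2] at h1
  rw [e1, norm_mul, norm_mul, Real.norm_of_nonneg (by positivity : 0 ≤ 1 / lam n),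
    Real.norm_of_nonneg (by positivity : 0 ≤ 1 / (n : ℝ))]
  calc 1 / lam n * (1 / n * ‖∑ i ∈ Finset.range n, (g (Z i ω) - m)‖)
      ≤ 1 / lam n * (1 / n * (K * (n / √(n / Real.log (Real.log n))))) := by gcongr
    _ = K * (lam n * √(n / Real.log (Real.log n)))⁻¹ := by field_simp

variable {ρ : Measure (Vec p × ℝ)} {Z : ℕ → Ω → Vec p × ℝ} {lam : ℕ → ℝ}

/-- The linear map that sends a matrix to its operator on Euclidean space. Being linear on a
finite-dimensional space it is continuous, which turns entrywise convergence of matrices into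
convergence in operator norm. -/
noncomputable def matrixToCLM (p : ℕ) :
    Matrix (Fin p) (Fin p) ℝ →ₗ[ℝ] (Vec p →L[ℝ] Vec p) :=
  (LinearMap.toContinuousLinearMap (𝕜 := ℝ) (E := Vec p) (F' := Vec p)).toLinearMap ∘ₗ
    (Matrix.toEuclideanLin (𝕜 := ℝ) (m := Fin p) (n := Fin p)).toLinearMap

/-- In operator norm, `empCov - cov = o(lam)` almost surely. -/
lemma ae_tendsto_inv_smul_empCov_sub (hZ : ∀ i, Measurable (Z i)) (hZρ : ∀ i, P.map (Z i) = ρ)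
    (hindep : iIndepFun Z P) (hx4 : Integrable (fun z : Vec p × ℝ => ‖z.1‖ ^ 4) ρ)
    (hy4 : Integrable (fun z : Vec p × ℝ => |z.2| ^ 4) ρ)
    (hrate : Tendsto (fun n : ℕ => lam n * Real.sqrt (n / Real.log (Real.log n))) atTop atTop) :
    ∀ᵐ ω ∂P, Tendsto (fun n => (1 / lam n) • LinearMap.toContinuousLinearMap
      (empCov (fun i => Z i ω) n - cov ρ)) atTop (𝓝 0) := by
  have h : ∀ᵐ ω ∂P, ∀ i j : Fin p, Tendsto (fun n : ℕ => 1 / lam n * ((1 / (n : ℝ)) *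
      ∑ k ∈ Finset.range n, (Z k ω).1 i * (Z k ω).1 j - ∫ z, z.1 i * z.1 j ∂ρ)) atTop (𝓝 0) :=
    ae_all_iff.2 fun i => ae_all_iff.2 fun j => ae_tendsto_inv_mul_empirical_mean_sub hZ hZρ hindep
      hrate (g := fun z : Vec p × ℝ => z.1 i * z.1 j) (by fun_prop)
      (memLp_two_coord_mul_coord hx4 hy4 i j)
  filter_upwards [h] with ω hω
  have hM : Tendsto (fun n : ℕ => (1 / lam n) • (((1 / (n : ℝ)) • ∑ k ∈ Finset.range n,
      Matrix.of fun i j => (Z k ω).1 i * (Z k ω).1 j) -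
      Matrix.of fun i j => ∫ z, z.1 i * z.1 j ∂ρ)) atTop (𝓝 (0 : Matrix (Fin p) (Fin p) ℝ)) := by
    refine tendsto_pi_nhds.2 fun i => tendsto_pi_nhds.2 fun j => ?_
    simpa [Matrix.sum_apply] using hω i j
  have hcont := ((matrixToCLM p).continuous_of_finiteDimensional.tendsto 0).comp hM
  rw [map_zero] at hcont
  refine hcont.congr fun n => ?_
  rw [Function.comp_apply, map_smul, map_sub, map_sub]
  rfl

lemma ae_tendsto_inv_smul_empU_sub (hZ : ∀ i, Measurable (Z i)) (hZρ : ∀ i, P.map (Z i) = ρ)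
    (hindep : iIndepFun Z P) (hx4 : Integrable (fun z : Vec p × ℝ => ‖z.1‖ ^ 4) ρ)
    (hy4 : Integrable (fun z : Vec p × ℝ => |z.2| ^ 4) ρ)
    (hrate : Tendsto (fun n : ℕ => lam n * Real.sqrt (n / Real.log (Real.log n))) atTop atTop) :
    ∀ᵐ ω ∂P, Tendsto (fun n => (1 / lam n) • (empU (fun i => Z i ω) n - crossCov ρ)) atTop
      (𝓝 0) := by
  have h : ∀ᵐ ω ∂P, ∀ j : Fin p, Tendsto (fun n : ℕ => 1 / lam n * ((1 / (n : ℝ)) *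
      ∑ k ∈ Finset.range n, (Z k ω).2 * (Z k ω).1 j - ∫ z, z.2 * z.1 j ∂ρ)) atTop (𝓝 0) :=
    ae_all_iff.2 fun j => ae_tendsto_inv_mul_empirical_mean_sub hZ hZρ hindep
      hrate (g := fun z : Vec p × ℝ => z.2 * z.1 j) (by fun_prop)
      (memLp_two_snd_mul_coord hx4 hy4 j)
  filter_upwards [h] with ω hω
  have h1 := ((PiLp.continuous_toLp 2 fun _ : Fin p => ℝ).tendsto 0).comp
    (tendsto_pi_nhds.2 hω)
  rw [WithLp.toLp_zero] at h1
  refine h1.congr fun n => ?_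
  ext j
  simp [empU, crossCov]

end Limits

end Risk

end MirrorERM

open MirrorERM MeasureTheory ProbabilityTheory Filter Topology in
theorem proposition2 {p : ℕ} {Ω : Type*} [MeasurableSpace Ω] (P : Measure Ω)
    [IsProbabilityMeasure P]
    -- the law of the data and the i.i.d. sample
    (ρ : Measure (Vec p × ℝ)) [IsProbabilityMeasure ρ]
    (Z : ℕ → Ω → Vec p × ℝ) (hZ : ∀ i, Measurable (Z i))
    (hZρ : ∀ i, P.map (Z i) = ρ) (hindep : iIndepFun Z P)
    (hx4 : Integrable (fun z : Vec p × ℝ => ‖z.1‖ ^ 4) ρ)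
    (hy4 : Integrable (fun z : Vec p × ℝ => |z.2| ^ 4) ρ)
    -- the regularizer
    (R : Vec p → EReal) (hR : IsMirrorStratifiable R) (hRbd : IsBoundedBelow R)
    -- `w₀` is the unique solution of the population problem
    (w₀ : Vec p) (hw₀ : IsPopulationSol ρ R w₀) (hw₀_unique : ∀ w, IsPopulationSol ρ R w → w = w₀)
    -- the problem that defines `η₀` is feasible
    (hfeas : (subdiff R w₀ ∩ (LinearMap.range (cov ρ) : Set (Vec p))).Nonempty)
    -- the regularization parameters
    (lam : ℕ → ℝ) (hlam_pos : ∀ n, 0 < lam n) (hlam : Tendsto lam atTop (𝓝 0))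
    (hlam_rate : Tendsto (fun n : ℕ => lam n * Real.sqrt (n / Real.log (Real.log n))) atTop atTop) :
    ∃ η₀ : Vec p, IsDualSol ρ R w₀ η₀ ∧ (∀ η, IsDualSol ρ R w₀ η → η = η₀) ∧
      ∀ᵐ ω ∂P,
        (∀ᶠ n in atTop, ∃ w, IsERMSol R (fun i => Z i ω) (lam n) n w) ∧
        ∀ w : ℕ → Vec p,
          (∀ᶠ n in atTop, IsERMSol R (fun i => Z i ω) (lam n) n (w n)) →
          Tendsto (fun n => (w n, dualVec (fun i => Z i ω) (lam n) n (w n))) atTop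
            (𝓝 (w₀, η₀)) := by
  obtain ⟨𝓜, 𝓜', hmir⟩ := hR
  have hbot := hmir.proper.1
  obtain ⟨r₀, hr⟩ : ∃ r₀ : ℝ, R w₀ = r₀ :=
    ⟨(R w₀).toReal, (EReal.coe_toReal hw₀.2.1 (hbot w₀)).symm⟩
  have hC := isPositive_cov hx4 hy4
  obtain ⟨η₀, hη₀, hmin, huniq⟩ :=
    exists_unique_isMinOn_pinv hC (isClosed_subdiff hr) (convex_subdiff hr) hfeas
  refine ⟨η₀, ⟨hη₀, hmin⟩, fun η hη => huniq η hη.1 hη.2, ?_⟩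
  have hrange : ∀ᵐ ω ∂P, ∀ i, (Z i ω).1 ∈ LinearMap.range (cov ρ) := by
    refine ae_all_iff.2 fun i => ?_
    have h := ae_fst_mem_range_cov hx4 hy4
    rw [← hZρ i] at h
    have := ae_of_ae_map (hZ i).aemeasurable h
    rwa [hZρ i] at this
  filter_upwards [hrange, ae_tendsto_inv_smul_empCov_sub hZ hZρ hindep hx4 hy4 hlam_rate,
    ae_tendsto_inv_smul_empU_sub hZ hZρ hindep hx4 hy4 hlam_rate] with ω hω hCω huω
  set s : ℕ → Vec p × ℝ := fun i => Z i ω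
  have he : Tendsto (fun n => ‖LinearMap.toContinuousLinearMap (empCov s n - cov ρ)‖) atTop
      (𝓝 0) := by
    have h := hlam.mul hCω.norm
    rw [zero_mul] at h
    refine h.congr fun n => ?_
    have hl := hlam_pos n
    rw [norm_smul, Real.norm_of_nonneg (by positivity), ← mul_assoc, mul_one_div_cancel hl.ne',
      one_mul]
  have hε : Tendsto (fun n => (1 / lam n) • (empU s n - empCov s n w₀)) atTop (𝓝 0) := by
    have h1 := ((ContinuousLinearMap.apply ℝ (Vec p) w₀).continuous.tendsto _).comp hCω
    have h := huω.sub h1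
    rw [map_zero, sub_zero] at h
    refine h.congr fun n => ?_
    simp only [Function.comp, ContinuousLinearMap.apply_apply, _root_.smul_apply,
      LinearMap.coe_toContinuousLinearMap', LinearMap.sub_apply,
      cov_eq_crossCov hx4 hy4 hw₀.1]
    module
  obtain ⟨hex, hconv⟩ := exists_isMinOn_and_tendsto hbot hmir.lsc hmir.convex hr hC
    (fun v hv hle => eq_zero_of_mem_ker_cov hx4 hy4 hw₀ hw₀_unique hv (hr ▸ hle)) hη₀ huniq
    hlam_pos hlam (isPositive_empCov s) (ker_le_ker_empCov hC.isSymmetric hω) he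
    (fun n v => (LinearMap.toContinuousLinearMap (empCov s n - cov ρ)).le_opNorm v)
    (empU_mem_range hω) hε
    (fun n => 1 / (2 * (n : ℝ)) * ∑ i ∈ Finset.range n, (s i).2 ^ 2)
  simp only [IsERMSol, ermObjective_eq_quadObj]
  exact ⟨hex, fun w hw => (hconv w hw).1.prodMk_nhds (hconv w hw).2⟩
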